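/- All algebras are finite-dimensional, not necessarily associative or unital algebras over $\mathbb{C}$. For an algebra $\mathbf{A}$ put $(x,y,z)=(xy)z-x(yz)$ and $x\circ y=\tfrac12(xy+yx)$. The algebra $\mathbf{A}$ is a \emph{Kokoris algebra} if $(x,y,x)=0$ for all $x,y\in\mathbf{A}$ and $(\mathbf{A},\circ)$ is associative. Put $\mathbf{A}^1=\mathbf{A}$ and $\mathbf{A}^n=\sum_{i=1}^{n-1}\mathbf{A}^i\mathbf{A}^{n-i}$ for $n\ge 2$; $\mathbf{A}$ is \emph{nilpotent} if $\mathbf{A}^n=0$ for some $n\geq 1$, and \emph{$2$-step nilpotent} if $\mathbf{A}^3=0$ (the zero multiplication is included). Theorem. Let $\mathcal{J}$ be a complex $4$-dimensional nilpotent Kokoris algebra. Then $\mathcal{J}$ is $2$-step nilpotent or isomorphic to one of the following ten algebras, given on a basis $e_1,e_2,e_3,e_4$ by their nonzero products of basis vectors: $$\begin{array}{lll} \mathcal{J}_{01}&:& e_1e_1=e_2,\ e_1e_2=e_3,\ e_2e_1=e_3\\ \mathcal{J}_{03}&:& e_1e_1=e_2,\ e_1e_2=e_4,\ e_2e_1=e_4,\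 e_3e_1=e_4,\ e_3e_3=e_4\\ \mathcal{J}_{04}&:& e_1e_1=e_2,\ e_1e_2=e_4,\ e_2e_1=e_4,\ e_3e_1=e_4\\ \mathcal{J}_{06}&:& e_1e_1=e_2,\ e_1e_2=e_4,\ e_2e_1=e_4,\ e_3e_3=e_4\\ \mathcal{J}_{13}&:& e_1e_2=e_3,\ e_1e_3=e_4,\ e_2e_1=-e_3,\ e_3e_1=-e_4\\ \mathcal{J}_{14}&:& e_1e_1=e_4,\ e_1e_2=e_3,\ e_1e_3=e_4,\ e_2e_1=-e_3,\ e_3e_1=-e_4\\ \mathcal{J}_{15}&:& e_1e_2=e_3,\ e_1e_3=e_4,\ e_2e_1=-e_3+e_4,\ e_3e_1=-e_4\\ \mathcal{J}_{16}&:& e_1e_2=e_3,\ e_1e_3=e_4,\ e_2e_1=-e_3,\ e_2e_2=e_4,\ e_3e_1=-e_4\\ \mathcal{J}_{17}&:& e_1e_1=e_4,\ e_1e_2=e_3,\ e_1e_3=e_4,\ e_2e_1=-e_3,\ e_2e_2=e_4,\ e_3e_1=-e_4\\ \mathcal{J}_{18}&:& e_1e_1=e_2,\ e_1e_2=e_3,\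 e_1e_3=e_4,\ e_2e_1=e_3,\ e_2e_2=e_4,\ e_3e_1=e_4 \end{array}$$ Moreover, each of these ten algebras is a $4$-dimensional nilpotent Kokoris algebra that is not $2$-step nilpotent, and the ten algebras are pairwise non-isomorphic. -/

import Mathlib

universe u

namespace Kokoris

section Notions

variable (A : Type u) [NonUnitalNonAssocRing A] [Module ℂ A]

/-- `IsFlexible A`: the identity `(x, y, x) = 0`, with `(x, y, z) = (x * y) * z - x * (y * z)`. -/
def IsFlexible : Prop := ∀ x y : A, associator x y x = 0

variable {A} in
/-- The product `x ∘ y = (x * y + y * x) / 2` of the algebra `A⁺`. -/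
noncomputable def circ (x y : A) : A := (1 / 2 : ℂ) • (x * y + y * x)

/-- A Kokoris algebra: a flexible algebra `A` such that `A⁺` is associative. -/
def IsKokoris : Prop :=
  IsFlexible A ∧ ∀ x y z : A, circ (circ x y) z = circ x (circ y z)

variable [IsScalarTower ℂ A A] [SMulCommClass ℂ A A]

/-- `powSucc A k` is the power `A ^ (k + 1)` of the nonassociative algebra `A`:
`A ^ 1 = A` and `A ^ n = A ^ 1 * A ^ (n - 1) + A ^ 2 * A ^ (n - 2) + ⋯ + A ^ (n - 1) * A ^ 1`,
where the product of two subspaces is the linear span of the products of their elements. -/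
noncomputable def powSucc : ℕ → Submodule ℂ A
  | 0 => ⊤
  | k + 1 => ⨆ i : Fin (k + 1),
      Submodule.map₂ (LinearMap.mul ℂ A) (powSucc i.val) (powSucc (k - i.val))
decreasing_by all_goals omega

/-- `A` is nilpotent: `A ^ n = 0` for some `n ≥ 1`. -/
def IsNilpotentAlgebra : Prop := ∃ k : ℕ, powSucc A k = ⊥

/-- `A` is 2-step nilpotent: `A ^ 3 = 0` (the zero multiplication is included). -/
def IsTwoStepNilpotent : Prop := powSucc A 2 = ⊥

end Notions

/-- Two complex algebras are isomorphic. -/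
def Isomorphic (A B : Type*) [NonUnitalNonAssocRing A] [Module ℂ A]
    [NonUnitalNonAssocRing B] [Module ℂ B] : Prop :=
  ∃ f : A →ₙₐ[ℂ] B, Function.Bijective f

/-- A multiplication table on the basis `e₁, e₂, e₃, e₄`: the entry in row `i` and column `j`
is the coordinate vector of the product of the `i`-th and the `j`-th basis vector. -/
abbrev Table : Type := Matrix (Fin 4) (Fin 4) (Fin 4 → ℂ)

/-- The 4-dimensional complex algebra on `ℂ⁴` with the given multiplication table. -/
def TableAlgebra (_T : Table) : Type := Fin 4 → ℂ

namespace TableAlgebra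

variable (T : Table)

instance : AddCommGroup (TableAlgebra T) := inferInstanceAs (AddCommGroup (Fin 4 → ℂ))

instance : Module ℂ (TableAlgebra T) := inferInstanceAs (Module ℂ (Fin 4 → ℂ))

/-- Bilinear extension of the table. -/
instance : Mul (TableAlgebra T) :=
  ⟨fun x y => (fun k => ∑ i, ∑ j, x i * y j * T i j k : Fin 4 → ℂ)⟩

theorem mul_apply (x y : TableAlgebra T) (k : Fin 4) :
    (x * y) k = ∑ i, ∑ j, x i * y j * T i j k := rfl

theorem add_apply (x y : TableAlgebra T) (k : Fin 4) : (x + y) k = x k + y k := rfl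

theorem zero_apply (k : Fin 4) : (0 : TableAlgebra T) k = 0 := rfl

theorem smul_apply (a : ℂ) (x : TableAlgebra T) (k : Fin 4) : (a • x) k = a * x k := rfl

instance : NonUnitalNonAssocRing (TableAlgebra T) :=
  { (inferInstance : AddCommGroup (TableAlgebra T)),
    (inferInstance : Mul (TableAlgebra T)) with
    left_distrib := fun x y z => by
      funext k
      simp only [mul_apply, add_apply, ← Finset.sum_add_distrib, mul_add, add_mul]
    right_distrib := fun x y z => by
      funext k
      simp only [mul_apply, add_apply, ← Finset.sum_add_distrib, add_mul]
    zero_mul := fun x => by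
      funext k
      simp [mul_apply, zero_apply]
    mul_zero := fun x => by
      funext k
      simp [mul_apply, zero_apply] }

instance : IsScalarTower ℂ (TableAlgebra T) (TableAlgebra T) :=
  ⟨fun a x y => by
    funext k
    simp only [smul_eq_mul, mul_apply, smul_apply, Finset.mul_sum, mul_assoc]⟩

instance : SMulCommClass ℂ (TableAlgebra T) (TableAlgebra T) :=
  ⟨fun a x y => by
    funext k
    simp only [smul_eq_mul, mul_apply, smul_apply, Finset.mul_sum]
    refine Finset.sum_congr rfl fun i _ => Finset.sum_congr rfl fun j _ => ?_
    ring⟩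

end TableAlgebra

/-- Coordinates of the basis vectors. -/
def e₁ : Fin 4 → ℂ := ![1, 0, 0, 0]
def e₂ : Fin 4 → ℂ := ![0, 1, 0, 0]
def e₃ : Fin 4 → ℂ := ![0, 0, 1, 0]
def e₄ : Fin 4 → ℂ := ![0, 0, 0, 1]

def J01 : Table := !![e₂, e₃, 0, 0;  e₃, 0, 0, 0;  0, 0, 0, 0;  0, 0, 0, 0]
def J03 : Table := !![e₂, e₄, 0, 0;  e₄, 0, 0, 0;  e₄, 0, e₄, 0;  0, 0, 0, 0]
def J04 : Table := !![e₂, e₄, 0, 0;  e₄, 0, 0, 0;  e₄, 0, 0, 0;  0, 0, 0, 0]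
def J06 : Table := !![e₂, e₄, 0, 0;  e₄, 0, 0, 0;  0, 0, e₄, 0;  0, 0, 0, 0]
def J13 : Table := !![0, e₃, e₄, 0;  -e₃, 0, 0, 0;  -e₄, 0, 0, 0;  0, 0, 0, 0]
def J14 : Table := !![e₄, e₃, e₄, 0;  -e₃, 0, 0, 0;  -e₄, 0, 0, 0;  0, 0, 0, 0]
def J15 : Table := !![0, e₃, e₄, 0;  -e₃ + e₄, 0, 0, 0;  -e₄, 0, 0, 0;  0, 0, 0, 0]
def J16 : Table := !![0, e₃, e₄, 0;  -e₃, e₄, 0, 0;  -e₄, 0, 0, 0;  0, 0, 0, 0]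
def J17 : Table := !![e₄, e₃, e₄, 0;  -e₃, e₄, 0, 0;  -e₄, 0, 0, 0;  0, 0, 0, 0]
def J18 : Table := !![e₂, e₃, e₄, 0;  e₃, e₄, 0, 0;  e₄, 0, 0, 0;  0, 0, 0, 0]

/-- The ten algebras of the classification. -/
def kokorisTable : Fin 10 → Table :=
  ![J01, J03, J04, J06, J13, J14, J15, J16, J17, J18]

end Kokoris

/-! Split the product as `x * y = circ x y + br x y`, with `br` half the commutator. Flexibility
makes every `br t` a derivation of `circ` (`IsKokoris.leibniz`), so a Kokoris algebra is a
commutative associative product and a bracket tied by the Leibniz rule. Powers are shifted by one: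
`powSucc A 1` is A² and `powSucc A 2` is A³.

A nilpotent algebra is generated by any complement of A² (`IsNilpotentAlgebra.eq_top`), so the
classification runs over dim A². If dim A² ≤ 1 then A³ = 0, because A³ is strictly smaller than a
nonzero A². If dim A² ≥ 3, one element x generates A; by Leibniz its powers commute with one
another, and A is spanned by x, x², x³, x⁴, which is J18.

If dim A² = 2 and A³ ≠ 0, then A²/A³ and A³ are lines and A³ annihilates A. When some cube x³ is
nonzero, x² and x³ span A², and a second generator y can be chosen with `circ x y = 0`. Leibniz and
associativity then push `br x y` and y² into A³, leaving two scalars, which rescaling reduces to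
J01, J03, J04, J06. When all cubes vanish, polarization kills every triple `circ` product; Leibniz
makes the bracket filiform and puts all `circ` products in A³, so `circ` amounts to a quadratic form
on A/A². Its normal forms under the base changes that fix the centralizer of A² modulo A² are J13 to
J17.

The ten tables are separated by properties of squares, cubes and commutation that any isomorphism
preserves. -/

namespace Kokoris

/-! ### The commutator bracket and the Leibniz rule -/

section Bracket

variable {A : Type u} [NonUnitalNonAssocRing A] [Module ℂ A]

/-- Half of the commutator. -/
noncomputable def br (x y : A) : A := (1 / 2 : ℂ) • (x * y - y * x)

theorem mul_eq_circ_add_br (x y : A) : x * y = circ x y + br x y := by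
  unfold circ br; module

theorem circ_comm (x y : A) : circ x y = circ y x := by
  unfold circ; module

theorem br_antisymm (x y : A) : br x y = -br y x := by
  unfold br; module

@[simp] theorem br_self (x : A) : br x x = 0 := by
  unfold br; module

@[simp] theorem circ_self (x : A) : circ x x = x * x := by
  unfold circ; module

theorem circ_add (x y z : A) : circ x (y + z) = circ x y + circ x z := by
  simp only [circ, mul_add, add_mul]; module

theorem add_circ (x y z : A) : circ (x + y) z = circ x z + circ y z := by
  simp only [circ, mul_add, add_mul]; module

theorem br_add (x y z : A) : br x (y + z) = br x y + br x z := by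
  simp only [br, mul_add, add_mul]; module

theorem add_br (x y z : A) : br (x + y) z = br x z + br y z := by
  simp only [br, mul_add, add_mul]; module

@[simp] theorem circ_zero (x : A) : circ x 0 = 0 := by simp [circ]

@[simp] theorem zero_circ (x : A) : circ 0 x = 0 := by simp [circ]

@[simp] theorem br_zero (x : A) : br x 0 = 0 := by simp [br]

theorem circ_neg (x y : A) : circ x (-y) = -circ x y := by
  simp only [circ, mul_neg, neg_mul]; module

theorem neg_circ (x y : A) : circ (-x) y = -circ x y := by
  simp only [circ, mul_neg, neg_mul]; module

theorem mul_eq_circ {x y : A} (h : br x y = 0) : x * y = circ x y := by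
  rw [mul_eq_circ_add_br, h, add_zero]

theorem br_eq_zero_symm {x y : A} (h : br x y = 0) : br y x = 0 := by
  rw [br_antisymm, h, neg_zero]

theorem IsFlexible.linearized {A : Type*} [NonUnitalNonAssocRing A] (h : IsFlexible A) (x y z : A) :
    (x * y) * z - x * (y * z) + ((z * y) * x - z * (y * x)) = 0 := by
  have h1 := h (x + z) y
  have h2 := h x y
  have h3 := h z y
  simp only [associator_apply, mul_add, add_mul] at h1 h2 h3
  linear_combination (norm := abel) h1 - h2 - h3

theorem IsKokoris.circ_assoc (h : IsKokoris A) (x y z : A) :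
    circ (circ x y) z = circ x (circ y z) := h.2 x y z

theorem IsKokoris.mul_self_mul (h : IsKokoris A) (x : A) : (x * x) * x = x * (x * x) := by
  have := h.1 x x
  rwa [associator_apply, sub_eq_zero] at this

variable [IsScalarTower ℂ A A] [SMulCommClass ℂ A A]

theorem circ_smul (a : ℂ) (x y : A) : circ x (a • y) = a • circ x y := by
  simp only [circ, smul_mul_assoc, mul_smul_comm]; module

theorem smul_circ (a : ℂ) (x y : A) : circ (a • x) y = a • circ x y := by
  simp only [circ, smul_mul_assoc, mul_smul_comm]; module

theorem br_smul (a : ℂ) (x y : A) : br x (a • y) = a • br x y := by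
  simp only [br, smul_mul_assoc, mul_smul_comm]; module

theorem smul_br (a : ℂ) (x y : A) : br (a • x) y = a • br x y := by
  simp only [br, smul_mul_assoc, mul_smul_comm]; module

/-- A linear combination of linearized flexibility at the triples (t, x, y), (t, y, x), (x, t, y);
associativity of `circ` plays no role. -/
theorem IsKokoris.leibniz (h : IsKokoris A) (t x y : A) :
    br t (circ x y) = circ (br t x) y + circ x (br t y) := by
  have h1 := h.1.linearized t x y
  have h2 := h.1.linearized t y x
  have h3 := h.1.linearized x t y
  simp only [circ, br, smul_mul_assoc, mul_smul_comm, mul_add, add_mul, mul_sub, sub_mul]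
  linear_combination (norm := module) (1 / 4 : ℂ) • h3 - (1 / 4 : ℂ) • h1 - (1 / 4 : ℂ) • h2

end Bracket

theorem apply_eq_zero_of_isNilpotent {A : Type*} [AddCommGroup A] [Module ℂ A]
    {f : A →ₗ[ℂ] A} (hf : IsNilpotent f) {w : A} {c : ℂ}
    (h : f w = c • w) : f w = 0 := by
  obtain ⟨n, hn⟩ := hf
  have h1 : (f ^ n) w = c ^ n • w := by
    clear hn
    induction n with
    | zero => simp
    | succ n ih => rw [pow_succ', Module.End.mul_apply, ih, map_smul, h, smul_smul, pow_succ]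
  rw [hn, LinearMap.zero_apply] at h1
  rcases smul_eq_zero.1 h1.symm with h2 | h2
  · rw [h, eq_zero_of_pow_eq_zero h2, zero_smul]
  · rw [h2, map_zero]

/-! ### Powers -/

section Powers

variable {A : Type u} [NonUnitalNonAssocRing A] [Module ℂ A]
  [IsScalarTower ℂ A A] [SMulCommClass ℂ A A]

theorem powSucc_zero : powSucc A 0 = ⊤ := by rw [powSucc]

theorem powSucc_succ (k : ℕ) : powSucc A (k + 1) = ⨆ i : Fin (k + 1),
    Submodule.map₂ (LinearMap.mul ℂ A) (powSucc A i.val) (powSucc A (k - i.val)) := by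
  rw [powSucc]

theorem mul_mem_powSucc {i j : ℕ} {x y : A} (hx : x ∈ powSucc A i) (hy : y ∈ powSucc A j) :
    x * y ∈ powSucc A (i + j + 1) := by
  rw [powSucc_succ]
  refine Submodule.mem_iSup_of_mem (⟨i, by omega⟩ : Fin (i + j + 1)) ?_
  have : i + j - i = j := by omega
  simp only [this]
  exact Submodule.apply_mem_map₂ (LinearMap.mul ℂ A) hx hy

theorem powSucc_succ_le {k : ℕ} {S : Submodule ℂ A}
    (h : ∀ i j, i + j = k → ∀ x ∈ powSucc A i, ∀ y ∈ powSucc A j, x * y ∈ S) :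
    powSucc A (k + 1) ≤ S := by
  rw [powSucc_succ]
  refine iSup_le fun i => Submodule.map₂_le.2 fun x hx y hy => ?_
  exact h i (k - i) (by omega) x hx y hy

theorem mul_mem_powSucc_one (x y : A) : x * y ∈ powSucc A 1 :=
  mul_mem_powSucc (i := 0) (j := 0) (by simp [powSucc_zero]) (by simp [powSucc_zero])

theorem mul_mem_powSucc_succ (x : A) {k : ℕ} {y : A} (hy : y ∈ powSucc A k) :
    x * y ∈ powSucc A (k + 1) := by
  have := mul_mem_powSucc (i := 0) (x := x) (by simp [powSucc_zero]) hy
  rwa [zero_add] at this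

theorem mul_mem_powSucc_succ' (x : A) {k : ℕ} {y : A} (hy : y ∈ powSucc A k) :
    y * x ∈ powSucc A (k + 1) :=
  mul_mem_powSucc (j := 0) (y := x) hy (by simp [powSucc_zero])

theorem powSucc_two_le_one : powSucc A 2 ≤ powSucc A 1 :=
  powSucc_succ_le fun _ _ _ x _ y _ => mul_mem_powSucc_one x y

theorem powSucc_two_le {S : Submodule ℂ A}
    (h : ∀ x, ∀ y ∈ powSucc A 1, x * y ∈ S ∧ y * x ∈ S) : powSucc A 2 ≤ S := by
  refine powSucc_succ_le fun i j hij x hx y hy => ?_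
  obtain ⟨rfl, rfl⟩ | ⟨rfl, rfl⟩ : (i = 0 ∧ j = 1) ∨ (i = 1 ∧ j = 0) := by omega
  · exact (h x y hy).1
  · exact (h y x hx).2

theorem pow_mulLeft_mem (x y : A) (n : ℕ) : ((LinearMap.mulLeft ℂ x) ^ n) y ∈ powSucc A n := by
  induction n with
  | zero => simp [powSucc_zero]
  | succ n ih => rw [pow_succ']; exact mul_mem_powSucc_succ x ih

theorem pow_mulRight_mem (x y : A) (n : ℕ) : ((LinearMap.mulRight ℂ x) ^ n) y ∈ powSucc A n := by
  induction n with
  | zero => simp [powSucc_zero]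
  | succ n ih => rw [pow_succ']; exact mul_mem_powSucc_succ' x ih

theorem IsNilpotentAlgebra.isNilpotent_mulLeft (h : IsNilpotentAlgebra A) (x : A) :
    IsNilpotent (LinearMap.mulLeft ℂ x) := by
  obtain ⟨k, hk⟩ := h
  refine ⟨k, LinearMap.ext fun y => ?_⟩
  have := pow_mulLeft_mem x y k
  rwa [hk, Submodule.mem_bot] at this

theorem IsNilpotentAlgebra.isNilpotent_mulRight (h : IsNilpotentAlgebra A) (x : A) :
    IsNilpotent (LinearMap.mulRight ℂ x) := by
  obtain ⟨k, hk⟩ := h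
  refine ⟨k, LinearMap.ext fun y => ?_⟩
  have := pow_mulRight_mem x y k
  rwa [hk, Submodule.mem_bot] at this

/-- On such a w all multiplications act by scalars, and a nilpotent operator has only the eigenvalue
0. This is what makes a one-dimensional A³ annihilate A. -/
theorem IsNilpotentAlgebra.annihilates_of_line (h : IsNilpotentAlgebra A) {w : A}
    (hl : ∀ x, x * w ∈ Submodule.span ℂ {w}) (hr : ∀ x, w * x ∈ Submodule.span ℂ {w}) (x : A) :
    x * w = 0 ∧ w * x = 0 := by
  obtain ⟨c, hc⟩ := Submodule.mem_span_singleton.1 (hl x)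
  obtain ⟨d, hd⟩ := Submodule.mem_span_singleton.1 (hr x)
  exact ⟨apply_eq_zero_of_isNilpotent (h.isNilpotent_mulLeft x) (w := w) hc.symm,
    apply_eq_zero_of_isNilpotent (h.isNilpotent_mulRight x) (w := w) hd.symm⟩

/-- A subalgebra which spans a nilpotent algebra modulo its square is the whole algebra. -/
theorem IsNilpotentAlgebra.eq_top (h : IsNilpotentAlgebra A) {S : Submodule ℂ A}
    (hS : ∀ x ∈ S, ∀ y ∈ S, x * y ∈ S) (hsup : S ⊔ powSucc A 1 = ⊤) : S = ⊤ := by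
  -- As in Nakayama's lemma: if x = s + u and y = t + v with s, t in S and u, v in the current
  -- power, then xy = st + sv + uy, where st lies in S and the other terms lie one power deeper.
  have key : ∀ k, S ⊔ powSucc A k = ⊤ := by
    intro k
    induction k with
    | zero => simp [powSucc_zero]
    | succ k ih =>
      rw [eq_top_iff, ← hsup]
      refine sup_le le_sup_left (powSucc_succ_le fun _ _ _ x _ y _ => ?_)
      obtain ⟨s, hs, u, hu, rfl⟩ := Submodule.mem_sup.1 (ih ▸ Submodule.mem_top : x ∈ S ⊔ powSucc A k)
      obtain ⟨t, ht, v, hv, rfl⟩ := Submodule.mem_sup.1 (ih ▸ Submodule.mem_top : y ∈ S ⊔ powSucc A k)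
      rw [add_mul, mul_add s]
      refine add_mem (add_mem ?_ ?_) ?_
      · exact Submodule.mem_sup_left (hS s hs t ht)
      · exact Submodule.mem_sup_right (mul_mem_powSucc_succ s hv)
      · exact Submodule.mem_sup_right (mul_mem_powSucc_succ' _ hu)
  obtain ⟨k, hk⟩ := h
  simpa [hk] using key k

theorem IsNilpotentAlgebra.powSucc_one_eq_bot (h : IsNilpotentAlgebra A)
    (h21 : powSucc A 2 = powSucc A 1) : powSucc A 1 = ⊥ := by
  -- If A² = A³, an inclusion of A² in some power propagates to the next, since A³ is spanned by
  -- products of A with A² on either side.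
  have key : ∀ k, powSucc A 1 ≤ powSucc A (k + 1) := by
    intro k
    induction k with
    | zero => exact le_rfl
    | succ k ih =>
      rw [← h21]
      exact powSucc_two_le fun x y hy =>
        ⟨mul_mem_powSucc_succ x (ih hy), mul_mem_powSucc_succ' x (ih hy)⟩
  obtain ⟨k, hk⟩ := h
  cases k with
  | zero =>
    rw [powSucc_zero] at hk
    exact le_bot_iff.1 (hk ▸ le_top)
  | succ k => exact le_bot_iff.1 (hk ▸ key k)

end Powers

/-! ### Isomorphism with a table algebra -/

theorem isomorphic_of_span {A : Type*} [NonUnitalNonAssocRing A] [Module ℂ A]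
    [IsScalarTower ℂ A A] [SMulCommClass ℂ A A] (hdim : Module.finrank ℂ A = 4) (T : Table)
    (v : Fin 4 → A) (hspan : ⊤ ≤ Submodule.span ℂ (Set.range v))
    (hmul : ∀ i j, v i * v j = ∑ k, T i j k • v k) : Isomorphic A (TableAlgebra T) := by
  let b := basisOfTopLeSpanOfCardEqFinrank v hspan (by simp [hdim])
  have hb : ∀ i, b i = v i := fun i => by simp [b]
  let g : A ≃ₗ[ℂ] (Fin 4 → ℂ) := b.equivFun
  have hg : ∀ x, x = ∑ i, g x i • v i := fun x => by
    conv_lhs => rw [← b.sum_equivFun x]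
    simp [g, hb]
  have hgv : ∀ c : Fin 4 → ℂ, g (∑ i, c i • v i) = c := fun c => by
    have : ∑ i, c i • v i = g.symm c := by simp [g, b.equivFun_symm_apply, hb]
    rw [this, g.apply_symm_apply]
  have hgm : ∀ x y k, g (x * y) k = ∑ i, ∑ j, g x i * g y j * T i j k := by
    intro x y k
    have : x * y = ∑ k, (∑ i, ∑ j, g x i * g y j * T i j k) • v k := by
      conv_lhs => rw [hg x, hg y]
      simp only [Finset.sum_mul_sum, smul_mul_smul_comm, hmul, Finset.smul_sum, Finset.sum_smul,
        smul_smul]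
      exact (Finset.sum_congr rfl fun i _ => Finset.sum_comm).trans Finset.sum_comm
    rw [this, hgv]
  let f : A →ₙₐ[ℂ] TableAlgebra T :=
    { toFun := fun x => g x
      map_smul' := fun a x => g.map_smul a x
      map_zero' := g.map_zero
      map_add' := fun x y => g.map_add x y
      map_mul' := fun x y => funext fun k => hgm x y k }
  exact ⟨f, g.bijective⟩

/-! ### Invariants -/

section Invariants

variable (A : Type*) [NonUnitalNonAssocRing A]

/-- Vanishing cubes single out J13 to J17. Among the others, `SquaresOfSquaresVanish` fails only for
J18; commutativity holds for J01 and J06 but not for J03 and J04, and `SquareZeroOfCubeZero` holds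
for J01 and J04 but not for J03 and J06. In J13 to J17 squaring is a quadratic form on A/A². It is
zero only for J13, and `SquareZeroAddClosed` detects rank one (J14, J16) against rank two (J15,
J17). The two Engel conditions compare the isotropic lines with the line x₀ = 0, which is where
x(xy) = 0 for all y. -/
def IsCommutative : Prop := ∀ x y : A, x * y = y * x

def CubesVanish : Prop := ∀ x : A, x * (x * x) = 0

def SquaresOfSquaresVanish : Prop := ∀ x : A, (x * x) * (x * x) = 0

def SquareZeroOfCubeZero : Prop := ∀ x : A, x * (x * x) = 0 → x * x = 0

def IsAlternating : Prop := ∀ x : A, x * x = 0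

def SquareZeroAddClosed : Prop :=
  ∀ x y : A, x * x = 0 → y * y = 0 → (x + y) * (x + y) = 0

def SquareZeroEngel : Prop := ∀ x : A, x * x = 0 → ∀ y, x * (x * y) = 0

def EngelRightAnnihilated : Prop :=
  ∀ x : A, x * x = 0 → (∀ y, x * (x * y) = 0) → ∀ y z, (x * y) * z = 0

end Invariants

/-! ### Invariance under isomorphism -/

section Transport

variable {A B : Type*} [NonUnitalNonAssocRing A] [Module ℂ A] [NonUnitalNonAssocRing B]
  [Module ℂ B]

theorem Isomorphic.symm (h : Isomorphic A B) : Isomorphic B A := by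
  obtain ⟨f, hf⟩ := h
  obtain ⟨g, hg⟩ := hf.surjective.hasRightInverse
  have hg' : Function.LeftInverse g f := hg.leftInverse_of_injective hf.injective
  exact ⟨f.inverse g hg' hg, hg.injective, hg'.surjective⟩

theorem Isomorphic.isCommutative (h : Isomorphic A B) (hA : IsCommutative A) :
    IsCommutative B := by
  obtain ⟨f, hf⟩ := h
  rw [IsCommutative, hf.surjective.forall₂]
  intro x y
  rw [← map_mul, ← map_mul, hA]

theorem Isomorphic.cubesVanish (h : Isomorphic A B) (hA : CubesVanish A) : CubesVanish B := by
  obtain ⟨f, hf⟩ := h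
  rw [CubesVanish, hf.surjective.forall]
  intro x
  rw [← map_mul, ← map_mul, hA, map_zero]

theorem Isomorphic.squaresOfSquaresVanish (h : Isomorphic A B)
    (hA : SquaresOfSquaresVanish A) : SquaresOfSquaresVanish B := by
  obtain ⟨f, hf⟩ := h
  rw [SquaresOfSquaresVanish, hf.surjective.forall]
  intro x
  rw [← map_mul, ← map_mul, hA, map_zero]

theorem Isomorphic.squareZeroOfCubeZero (h : Isomorphic A B)
    (hA : SquareZeroOfCubeZero A) : SquareZeroOfCubeZero B := by
  obtain ⟨f, hf⟩ := h
  rw [SquareZeroOfCubeZero, hf.surjective.forall]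
  intro x
  simp only [← map_mul, map_eq_zero_iff f hf.injective]
  exact hA x

theorem Isomorphic.isAlternating (h : Isomorphic A B) (hA : IsAlternating A) :
    IsAlternating B := by
  obtain ⟨f, hf⟩ := h
  rw [IsAlternating, hf.surjective.forall]
  intro x
  rw [← map_mul, hA, map_zero]

theorem Isomorphic.squareZeroAddClosed (h : Isomorphic A B)
    (hA : SquareZeroAddClosed A) : SquareZeroAddClosed B := by
  obtain ⟨f, hf⟩ := h
  rw [SquareZeroAddClosed, hf.surjective.forall₂]
  intro x y
  simp only [← map_mul, ← map_add, map_eq_zero_iff f hf.injective]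
  exact hA x y

theorem Isomorphic.squareZeroEngel (h : Isomorphic A B)
    (hA : SquareZeroEngel A) : SquareZeroEngel B := by
  obtain ⟨f, hf⟩ := h
  rw [SquareZeroEngel, hf.surjective.forall]
  intro x
  simp only [hf.surjective.forall, ← map_mul, map_eq_zero_iff f hf.injective]
  exact hA x

theorem Isomorphic.engelRightAnnihilated (h : Isomorphic A B)
    (hA : EngelRightAnnihilated A) : EngelRightAnnihilated B := by
  obtain ⟨f, hf⟩ := h
  rw [EngelRightAnnihilated, hf.surjective.forall]
  intro x
  simp only [hf.surjective.forall, ← map_mul, map_eq_zero_iff f hf.injective]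
  exact hA x

end Transport

/-! ### The tables -/

namespace TableAlgebra

variable {T : Table}

@[ext] theorem ext {x y : TableAlgebra T} (h0 : x 0 = y 0) (h1 : x 1 = y 1) (h2 : x 2 = y 2)
    (h3 : x 3 = y 3) : x = y := by
  funext k
  fin_cases k <;> assumption

theorem eq_zero_iff {x : TableAlgebra T} :
    x = 0 ↔ x 0 = 0 ∧ x 1 = 0 ∧ x 2 = 0 ∧ x 3 = 0 := by
  refine ⟨fun h => by simp [h, zero_apply], fun h => ?_⟩
  exact ext h.1 h.2.1 h.2.2.1 h.2.2.2

/-- The vector with the given coordinates. -/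
def mk (T : Table) (c : Fin 4 → ℂ) : TableAlgebra T := c

theorem mk_apply (T : Table) (c : Fin 4 → ℂ) (k : Fin 4) : mk T c k = c k := rfl

theorem finrank_eq_four (T : Table) : Module.finrank ℂ (TableAlgebra T) = 4 :=
  Module.finrank_fin_fun ℂ

/-- If the table is compatible with a weight of the basis vectors, then the powers of the algebra
lie in the weight filtration. -/
theorem powSucc_apply_eq_zero (w : Fin 4 → ℕ) (hw : ∀ i, 1 ≤ w i)
    (hT : ∀ i j k, w k < w i + w j → T i j k = 0) (n : ℕ) :
    ∀ x ∈ powSucc (TableAlgebra T) n, ∀ i, w i < n + 1 → x i = 0 := by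
  induction n using Nat.strong_induction_on with
  | _ n ih =>
    cases n with
    | zero =>
      intro x _ i hi
      have := hw i
      omega
    | succ n =>
      let S : Submodule ℂ (TableAlgebra T) :=
        { carrier := {x | ∀ i, w i < n + 1 + 1 → x i = 0}
          zero_mem' := fun i _ => rfl
          add_mem' := fun {x y} hx hy i hi => by rw [add_apply, hx i hi, hy i hi, add_zero]
          smul_mem' := fun a x hx i hi => by rw [smul_apply, hx i hi, mul_zero] }
      change powSucc (TableAlgebra T) (n + 1) ≤ S
      refine powSucc_succ_le fun a b hab x hx y hy k hk => ?_
      rw [mul_apply]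
      refine Finset.sum_eq_zero fun i _ => Finset.sum_eq_zero fun j _ => ?_
      by_cases hi : w i < a + 1
      · rw [ih a (by omega) x hx i hi, zero_mul, zero_mul]
      by_cases hj : w j < b + 1
      · rw [ih b (by omega) y hy j hj, mul_zero, zero_mul]
      rw [hT i j k (by omega), mul_zero]

theorem isNilpotentAlgebra (w : Fin 4 → ℕ) (hw : ∀ i, 1 ≤ w i ∧ w i ≤ 4)
    (hT : ∀ i j k, w k < w i + w j → T i j k = 0) : IsNilpotentAlgebra (TableAlgebra T) := by
  refine ⟨4, le_bot_iff.1 fun x hx => ?_⟩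
  funext i
  -- Index 4 stands for A⁵, whose elements have no component of weight at most 4.
  exact powSucc_apply_eq_zero w (fun i => (hw i).1) hT 4 x hx i (by have := (hw i).2; omega)

end TableAlgebra

theorem IsTwoStepNilpotent.mul_mul_eq_zero {A : Type*} [NonUnitalNonAssocRing A] [Module ℂ A]
    [IsScalarTower ℂ A A] [SMulCommClass ℂ A A] (h : IsTwoStepNilpotent A) (x y z : A) :
    x * (y * z) = 0 := by
  have := mul_mem_powSucc_succ x (mul_mem_powSucc_one y z)
  rwa [h, Submodule.mem_bot] at this

open TableAlgebra

/-! ### Multiplication formulas and verification of the ten tables -/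

section Products

set_option linter.unusedSimpArgs false
set_option linter.unnecessarySeqFocus false

theorem mul_J01 (x y : TableAlgebra J01) :
    x * y = mk J01 ![0, x 0 * y 0, x 0 * y 1 + x 1 * y 0, 0] := by
  ext <;> rw [TableAlgebra.mul_apply] <;>
    simp [mk_apply, J01, e₁, e₂, e₃, e₄, Fin.sum_univ_four]

theorem mul_J03 (x y : TableAlgebra J03) :
    x * y = mk J03 ![0, x 0 * y 0, 0, x 0 * y 1 + x 1 * y 0 + x 2 * y 0 + x 2 * y 2] := by
  ext <;> rw [TableAlgebra.mul_apply] <;>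
    simp [mk_apply, J03, e₁, e₂, e₃, e₄, Fin.sum_univ_four] <;> ring

theorem mul_J04 (x y : TableAlgebra J04) :
    x * y = mk J04 ![0, x 0 * y 0, 0, x 0 * y 1 + x 1 * y 0 + x 2 * y 0] := by
  ext <;> rw [TableAlgebra.mul_apply] <;>
    simp [mk_apply, J04, e₁, e₂, e₃, e₄, Fin.sum_univ_four]

theorem mul_J06 (x y : TableAlgebra J06) :
    x * y = mk J06 ![0, x 0 * y 0, 0, x 0 * y 1 + x 1 * y 0 + x 2 * y 2] := by
  ext <;> rw [TableAlgebra.mul_apply] <;>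
    simp [mk_apply, J06, e₁, e₂, e₃, e₄, Fin.sum_univ_four]

theorem mul_J13 (x y : TableAlgebra J13) :
    x * y = mk J13 ![0, 0, x 0 * y 1 - x 1 * y 0, x 0 * y 2 - x 2 * y 0] := by
  ext <;> rw [TableAlgebra.mul_apply] <;>
    simp [mk_apply, J13, e₁, e₂, e₃, e₄, Fin.sum_univ_four] <;> ring

theorem mul_J14 (x y : TableAlgebra J14) :
    x * y = mk J14 ![0, 0, x 0 * y 1 - x 1 * y 0, x 0 * y 2 - x 2 * y 0 + x 0 * y 0] := by
  ext <;> rw [TableAlgebra.mul_apply] <;>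
    simp [mk_apply, J14, e₁, e₂, e₃, e₄, Fin.sum_univ_four] <;> ring

theorem mul_J15 (x y : TableAlgebra J15) :
    x * y = mk J15 ![0, 0, x 0 * y 1 - x 1 * y 0, x 0 * y 2 - x 2 * y 0 + x 1 * y 0] := by
  ext <;> rw [TableAlgebra.mul_apply] <;>
    simp [mk_apply, J15, e₁, e₂, e₃, e₄, Fin.sum_univ_four] <;> ring

theorem mul_J16 (x y : TableAlgebra J16) :
    x * y = mk J16 ![0, 0, x 0 * y 1 - x 1 * y 0, x 0 * y 2 - x 2 * y 0 + x 1 * y 1] := by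
  ext <;> rw [TableAlgebra.mul_apply] <;>
    simp [mk_apply, J16, e₁, e₂, e₃, e₄, Fin.sum_univ_four] <;> ring

theorem mul_J17 (x y : TableAlgebra J17) :
    x * y = mk J17 ![0, 0, x 0 * y 1 - x 1 * y 0, x 0 * y 2 - x 2 * y 0 + x 0 * y 0 + x 1 * y 1] := by
  ext <;> rw [TableAlgebra.mul_apply] <;>
    simp [mk_apply, J17, e₁, e₂, e₃, e₄, Fin.sum_univ_four] <;> ring

theorem mul_J18 (x y : TableAlgebra J18) :
    x * y = mk J18 ![0, x 0 * y 0, x 0 * y 1 + x 1 * y 0, x 0 * y 2 + x 1 * y 1 + x 2 * y 0] := by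
  ext <;> rw [TableAlgebra.mul_apply] <;>
    simp [mk_apply, J18, e₁, e₂, e₃, e₄, Fin.sum_univ_four]

theorem isKokoris_J01 : IsKokoris (TableAlgebra J01) := by
  refine ⟨fun x y => ?_, fun x y z => ?_⟩
  · rw [associator_apply, sub_eq_zero]
    ext <;> simp [mul_J01, mk_apply] <;> ring
  · ext <;> simp [circ, mul_J01, mk_apply, add_apply, smul_apply] <;> ring

theorem isNilpotentAlgebra_J01 : IsNilpotentAlgebra (TableAlgebra J01) := by
  refine isNilpotentAlgebra ![1,2,3,1] (by decide) fun i j k => ?_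
  fin_cases i <;> fin_cases j <;> fin_cases k <;> simp [J01, e₁, e₂, e₃, e₄]

theorem not_isTwoStepNilpotent_J01 : ¬ IsTwoStepNilpotent (TableAlgebra J01) := fun h => by
  have := congrFun (h.mul_mul_eq_zero (mk J01 e₁) (mk J01 e₁) (mk J01 e₁)) 2
  simp [mul_J01, mk_apply, e₁, e₂, zero_apply] at this

theorem isKokoris_J03 : IsKokoris (TableAlgebra J03) := by
  refine ⟨fun x y => ?_, fun x y z => ?_⟩
  · rw [associator_apply, sub_eq_zero]
    ext <;> simp [mul_J03, mk_apply] <;> ring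
  · ext <;> simp [circ, mul_J03, mk_apply, add_apply, smul_apply] <;> ring

theorem isNilpotentAlgebra_J03 : IsNilpotentAlgebra (TableAlgebra J03) := by
  refine isNilpotentAlgebra ![1,2,1,3] (by decide) fun i j k => ?_
  fin_cases i <;> fin_cases j <;> fin_cases k <;> simp [J03, e₁, e₂, e₃, e₄]

theorem not_isTwoStepNilpotent_J03 : ¬ IsTwoStepNilpotent (TableAlgebra J03) := fun h => by
  have := congrFun (h.mul_mul_eq_zero (mk J03 e₁) (mk J03 e₁) (mk J03 e₁)) 3
  simp [mul_J03, mk_apply, e₁, e₂, zero_apply] at this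

theorem isKokoris_J04 : IsKokoris (TableAlgebra J04) := by
  refine ⟨fun x y => ?_, fun x y z => ?_⟩
  · rw [associator_apply, sub_eq_zero]
    ext <;> simp [mul_J04, mk_apply] <;> ring
  · ext <;> simp [circ, mul_J04, mk_apply, add_apply, smul_apply] <;> ring

theorem isNilpotentAlgebra_J04 : IsNilpotentAlgebra (TableAlgebra J04) := by
  refine isNilpotentAlgebra ![1,2,1,3] (by decide) fun i j k => ?_
  fin_cases i <;> fin_cases j <;> fin_cases k <;> simp [J04, e₁, e₂, e₃, e₄]

theorem not_isTwoStepNilpotent_J04 : ¬ IsTwoStepNilpotent (TableAlgebra J04) := fun h => by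
  have := congrFun (h.mul_mul_eq_zero (mk J04 e₁) (mk J04 e₁) (mk J04 e₁)) 3
  simp [mul_J04, mk_apply, e₁, e₂, zero_apply] at this

theorem isKokoris_J06 : IsKokoris (TableAlgebra J06) := by
  refine ⟨fun x y => ?_, fun x y z => ?_⟩
  · rw [associator_apply, sub_eq_zero]
    ext <;> simp [mul_J06, mk_apply] <;> ring
  · ext <;> simp [circ, mul_J06, mk_apply, add_apply, smul_apply] <;> ring

theorem isNilpotentAlgebra_J06 : IsNilpotentAlgebra (TableAlgebra J06) := by
  refine isNilpotentAlgebra ![1,2,1,3] (by decide) fun i j k => ?_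
  fin_cases i <;> fin_cases j <;> fin_cases k <;> simp [J06, e₁, e₂, e₃, e₄]

theorem not_isTwoStepNilpotent_J06 : ¬ IsTwoStepNilpotent (TableAlgebra J06) := fun h => by
  have := congrFun (h.mul_mul_eq_zero (mk J06 e₁) (mk J06 e₁) (mk J06 e₁)) 3
  simp [mul_J06, mk_apply, e₁, e₂, zero_apply] at this

theorem isKokoris_J13 : IsKokoris (TableAlgebra J13) := by
  refine ⟨fun x y => ?_, fun x y z => ?_⟩
  · rw [associator_apply, sub_eq_zero]
    ext <;> simp [mul_J13, mk_apply] <;> ring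
  · ext <;> simp [circ, mul_J13, mk_apply, add_apply, smul_apply] <;> ring

theorem isNilpotentAlgebra_J13 : IsNilpotentAlgebra (TableAlgebra J13) := by
  refine isNilpotentAlgebra ![1,1,2,3] (by decide) fun i j k => ?_
  fin_cases i <;> fin_cases j <;> fin_cases k <;> simp [J13, e₁, e₂, e₃, e₄]

theorem not_isTwoStepNilpotent_J13 : ¬ IsTwoStepNilpotent (TableAlgebra J13) := fun h => by
  have := congrFun (h.mul_mul_eq_zero (mk J13 e₁) (mk J13 e₁) (mk J13 e₂)) 3
  simp [mul_J13, mk_apply, e₁, e₂, zero_apply] at this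

theorem isKokoris_J14 : IsKokoris (TableAlgebra J14) := by
  refine ⟨fun x y => ?_, fun x y z => ?_⟩
  · rw [associator_apply, sub_eq_zero]
    ext <;> simp [mul_J14, mk_apply] <;> ring
  · ext <;> simp [circ, mul_J14, mk_apply, add_apply, smul_apply] <;> ring

theorem isNilpotentAlgebra_J14 : IsNilpotentAlgebra (TableAlgebra J14) := by
  refine isNilpotentAlgebra ![1,1,2,3] (by decide) fun i j k => ?_
  fin_cases i <;> fin_cases j <;> fin_cases k <;> simp [J14, e₁, e₂, e₃, e₄]

theorem not_isTwoStepNilpotent_J14 : ¬ IsTwoStepNilpotent (TableAlgebra J14) := fun h => by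
  have := congrFun (h.mul_mul_eq_zero (mk J14 e₁) (mk J14 e₁) (mk J14 e₂)) 3
  simp [mul_J14, mk_apply, e₁, e₂, zero_apply] at this

theorem isKokoris_J15 : IsKokoris (TableAlgebra J15) := by
  refine ⟨fun x y => ?_, fun x y z => ?_⟩
  · rw [associator_apply, sub_eq_zero]
    ext <;> simp [mul_J15, mk_apply] <;> ring
  · ext <;> simp [circ, mul_J15, mk_apply, add_apply, smul_apply] <;> ring

theorem isNilpotentAlgebra_J15 : IsNilpotentAlgebra (TableAlgebra J15) := by
  refine isNilpotentAlgebra ![1,1,2,3] (by decide) fun i j k => ?_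
  fin_cases i <;> fin_cases j <;> fin_cases k <;> simp [J15, e₁, e₂, e₃, e₄]

theorem not_isTwoStepNilpotent_J15 : ¬ IsTwoStepNilpotent (TableAlgebra J15) := fun h => by
  have := congrFun (h.mul_mul_eq_zero (mk J15 e₁) (mk J15 e₁) (mk J15 e₂)) 3
  simp [mul_J15, mk_apply, e₁, e₂, zero_apply] at this

theorem isKokoris_J16 : IsKokoris (TableAlgebra J16) := by
  refine ⟨fun x y => ?_, fun x y z => ?_⟩
  · rw [associator_apply, sub_eq_zero]
    ext <;> simp [mul_J16, mk_apply] <;> ring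
  · ext <;> simp [circ, mul_J16, mk_apply, add_apply, smul_apply] <;> ring

theorem isNilpotentAlgebra_J16 : IsNilpotentAlgebra (TableAlgebra J16) := by
  refine isNilpotentAlgebra ![1,1,2,3] (by decide) fun i j k => ?_
  fin_cases i <;> fin_cases j <;> fin_cases k <;> simp [J16, e₁, e₂, e₃, e₄]

theorem not_isTwoStepNilpotent_J16 : ¬ IsTwoStepNilpotent (TableAlgebra J16) := fun h => by
  have := congrFun (h.mul_mul_eq_zero (mk J16 e₁) (mk J16 e₁) (mk J16 e₂)) 3
  simp [mul_J16, mk_apply, e₁, e₂, zero_apply] at this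

theorem isKokoris_J17 : IsKokoris (TableAlgebra J17) := by
  refine ⟨fun x y => ?_, fun x y z => ?_⟩
  · rw [associator_apply, sub_eq_zero]
    ext <;> simp [mul_J17, mk_apply] <;> ring
  · ext <;> simp [circ, mul_J17, mk_apply, add_apply, smul_apply] <;> ring

theorem isNilpotentAlgebra_J17 : IsNilpotentAlgebra (TableAlgebra J17) := by
  refine isNilpotentAlgebra ![1,1,2,3] (by decide) fun i j k => ?_
  fin_cases i <;> fin_cases j <;> fin_cases k <;> simp [J17, e₁, e₂, e₃, e₄]

theorem not_isTwoStepNilpotent_J17 : ¬ IsTwoStepNilpotent (TableAlgebra J17) := fun h => by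
  have := congrFun (h.mul_mul_eq_zero (mk J17 e₁) (mk J17 e₁) (mk J17 e₂)) 3
  simp [mul_J17, mk_apply, e₁, e₂, zero_apply] at this

theorem isKokoris_J18 : IsKokoris (TableAlgebra J18) := by
  refine ⟨fun x y => ?_, fun x y z => ?_⟩
  · rw [associator_apply, sub_eq_zero]
    ext <;> simp [mul_J18, mk_apply] <;> ring
  · ext <;> simp [circ, mul_J18, mk_apply, add_apply, smul_apply] <;> ring

theorem isNilpotentAlgebra_J18 : IsNilpotentAlgebra (TableAlgebra J18) := by
  refine isNilpotentAlgebra ![1,2,3,4] (by decide) fun i j k => ?_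
  fin_cases i <;> fin_cases j <;> fin_cases k <;> simp [J18, e₁, e₂, e₃, e₄]

theorem not_isTwoStepNilpotent_J18 : ¬ IsTwoStepNilpotent (TableAlgebra J18) := fun h => by
  have := congrFun (h.mul_mul_eq_zero (mk J18 e₁) (mk J18 e₁) (mk J18 e₁)) 2
  simp [mul_J18, mk_apply, e₁, e₂, zero_apply] at this

end Products

/-! ### The ten algebras are pairwise non-isomorphic -/

section Separation

set_option linter.unusedSimpArgs false
set_option linter.unnecessarySeqFocus false

theorem cubesVanish_J13 : CubesVanish (TableAlgebra J13) := fun x => by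
  ext <;> simp [mul_J13, mk_apply, zero_apply, mul_comm (x 1) (x 0)]

theorem cubesVanish_J14 : CubesVanish (TableAlgebra J14) := fun x => by
  ext <;> simp [mul_J14, mk_apply, zero_apply, mul_comm (x 1) (x 0)]

theorem cubesVanish_J15 : CubesVanish (TableAlgebra J15) := fun x => by
  ext <;> simp [mul_J15, mk_apply, zero_apply, mul_comm (x 1) (x 0)]

theorem cubesVanish_J16 : CubesVanish (TableAlgebra J16) := fun x => by
  ext <;> simp [mul_J16, mk_apply, zero_apply, mul_comm (x 1) (x 0)]

theorem cubesVanish_J17 : CubesVanish (TableAlgebra J17) := fun x => by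
  ext <;> simp [mul_J17, mk_apply, zero_apply, mul_comm (x 1) (x 0)]

theorem not_cubesVanish_J01 : ¬ CubesVanish (TableAlgebra J01) := fun h => by
  have := congrFun (h (mk J01 e₁)) 2
  simp [mul_J01, mk_apply, add_apply, e₁, e₂, e₃, zero_apply] at this

theorem not_cubesVanish_J03 : ¬ CubesVanish (TableAlgebra J03) := fun h => by
  have := congrFun (h (mk J03 e₁)) 3
  simp [mul_J03, mk_apply, add_apply, e₁, e₂, e₃, zero_apply] at this

theorem not_cubesVanish_J04 : ¬ CubesVanish (TableAlgebra J04) := fun h => by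
  have := congrFun (h (mk J04 e₁)) 3
  simp [mul_J04, mk_apply, add_apply, e₁, e₂, e₃, zero_apply] at this

theorem not_cubesVanish_J06 : ¬ CubesVanish (TableAlgebra J06) := fun h => by
  have := congrFun (h (mk J06 e₁)) 3
  simp [mul_J06, mk_apply, add_apply, e₁, e₂, e₃, zero_apply] at this

theorem not_cubesVanish_J18 : ¬ CubesVanish (TableAlgebra J18) := fun h => by
  have := congrFun (h (mk J18 e₁)) 2
  simp [mul_J18, mk_apply, add_apply, e₁, e₂, e₃, zero_apply] at this

theorem squaresOfSquaresVanish_J01 : SquaresOfSquaresVanish (TableAlgebra J01) := fun x => by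
  ext <;> simp [mul_J01, mk_apply, zero_apply]

theorem squaresOfSquaresVanish_J03 : SquaresOfSquaresVanish (TableAlgebra J03) := fun x => by
  ext <;> simp [mul_J03, mk_apply, zero_apply]

theorem squaresOfSquaresVanish_J04 : SquaresOfSquaresVanish (TableAlgebra J04) := fun x => by
  ext <;> simp [mul_J04, mk_apply, zero_apply]

theorem squaresOfSquaresVanish_J06 : SquaresOfSquaresVanish (TableAlgebra J06) := fun x => by
  ext <;> simp [mul_J06, mk_apply, zero_apply]

theorem not_squaresOfSquaresVanish_J18 : ¬ SquaresOfSquaresVanish (TableAlgebra J18) := fun h => by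
  have := congrFun (h (mk J18 e₁)) 3
  simp [mul_J18, mk_apply, add_apply, e₁, e₂, e₃, zero_apply] at this

theorem isCommutative_J01 : IsCommutative (TableAlgebra J01) := fun x y => by
  ext <;> simp [mul_J01, mk_apply] <;> ring

theorem isCommutative_J06 : IsCommutative (TableAlgebra J06) := fun x y => by
  ext <;> simp [mul_J06, mk_apply] <;> ring

theorem not_isCommutative_J03 : ¬ IsCommutative (TableAlgebra J03) := fun h => by
  have := congrFun (h (mk J03 e₁) (mk J03 e₃)) 3
  simp [mul_J03, mk_apply, add_apply, e₁, e₂, e₃, zero_apply] at this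

theorem not_isCommutative_J04 : ¬ IsCommutative (TableAlgebra J04) := fun h => by
  have := congrFun (h (mk J04 e₁) (mk J04 e₃)) 3
  simp [mul_J04, mk_apply, add_apply, e₁, e₂, e₃, zero_apply] at this

theorem squareZeroOfCubeZero_J01 : SquareZeroOfCubeZero (TableAlgebra J01) := fun x hx => by
  simp [eq_zero_iff, mul_J01, mk_apply] at hx ⊢
  simp [hx]

theorem squareZeroOfCubeZero_J04 : SquareZeroOfCubeZero (TableAlgebra J04) := fun x hx => by
  simp [eq_zero_iff, mul_J04, mk_apply] at hx ⊢
  simp [hx]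

theorem not_squareZeroOfCubeZero_J03 : ¬ SquareZeroOfCubeZero (TableAlgebra J03) := fun h => by
  have := congrFun (h (mk J03 e₃) (by simp [eq_zero_iff, mul_J03, mk_apply, e₁, e₂, e₃])) 3
  simp [mul_J03, mk_apply, add_apply, e₁, e₂, e₃, zero_apply] at this

theorem not_squareZeroOfCubeZero_J06 : ¬ SquareZeroOfCubeZero (TableAlgebra J06) := fun h => by
  have := congrFun (h (mk J06 e₃) (by simp [eq_zero_iff, mul_J06, mk_apply, e₁, e₂, e₃])) 3
  simp [mul_J06, mk_apply, add_apply, e₁, e₂, e₃, zero_apply] at this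

theorem isAlternating_J13 : IsAlternating (TableAlgebra J13) := fun x => by
  ext <;> simp [mul_J13, mk_apply, zero_apply] <;> ring

theorem not_isAlternating_J14 : ¬ IsAlternating (TableAlgebra J14) := fun h => by
  have := congrFun (h (mk J14 e₁)) 3
  simp [mul_J14, mk_apply, add_apply, e₁, e₂, e₃, zero_apply] at this

theorem not_isAlternating_J15 : ¬ IsAlternating (TableAlgebra J15) := fun h => by
  -- The squaring form here is x₀x₁, so neither e₁ nor e₂ alone would do.
  have := congrFun (h (mk J15 (e₁ + e₂))) 3
  simp [mul_J15, mk_apply, add_apply, e₁, e₂, e₃, zero_apply] at this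

theorem not_isAlternating_J16 : ¬ IsAlternating (TableAlgebra J16) := fun h => by
  have := congrFun (h (mk J16 e₂)) 3
  simp [mul_J16, mk_apply, add_apply, e₁, e₂, e₃, zero_apply] at this

theorem not_isAlternating_J17 : ¬ IsAlternating (TableAlgebra J17) := fun h => by
  have := congrFun (h (mk J17 e₁)) 3
  simp [mul_J17, mk_apply, add_apply, e₁, e₂, e₃, zero_apply] at this

theorem squareZeroAddClosed_J14 : SquareZeroAddClosed (TableAlgebra J14) := fun x y hx hy => by
  have hx' : x 0 * x 0 = 0 := by
    have := congrFun hx 3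
    simp only [mul_J14, mk_apply, zero_apply] at this
    simpa [mul_comm] using this
  have hy' : y 0 * y 0 = 0 := by
    have := congrFun hy 3
    simp only [mul_J14, mk_apply, zero_apply] at this
    simpa [mul_comm] using this
  rw [mul_self_eq_zero] at hx' hy'
  ext <;> simp [mul_J14, mk_apply, zero_apply, add_apply, hx', hy']

theorem squareZeroAddClosed_J16 : SquareZeroAddClosed (TableAlgebra J16) := fun x y hx hy => by
  have hx' : x 1 * x 1 = 0 := by
    have := congrFun hx 3
    simp only [mul_J16, mk_apply, zero_apply] at this
    simpa [mul_comm] using this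
  have hy' : y 1 * y 1 = 0 := by
    have := congrFun hy 3
    simp only [mul_J16, mk_apply, zero_apply] at this
    simpa [mul_comm] using this
  rw [mul_self_eq_zero] at hx' hy'
  ext <;> simp [mul_J16, mk_apply, zero_apply, add_apply, hx', hy']; ring

theorem not_squareZeroAddClosed_J15 : ¬ SquareZeroAddClosed (TableAlgebra J15) := fun h => by
  have := congrFun (h (mk J15 e₁) (mk J15 e₂) (by simp [eq_zero_iff, mul_J15, mk_apply, e₁, e₂, e₃]) (by simp [eq_zero_iff, mul_J15, mk_apply, e₁, e₂, e₃])) 3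
  simp [mul_J15, mk_apply, add_apply, e₁, e₂, e₃, zero_apply] at this

theorem not_squareZeroAddClosed_J17 : ¬ SquareZeroAddClosed (TableAlgebra J17) := fun h => by
  -- These vectors lie on the two isotropic lines of x₀² + x₁².
  have := congrFun (h (mk J17 ![1, Complex.I, 0, 0]) (mk J17 ![1, -Complex.I, 0, 0])
    (by simp [eq_zero_iff, mul_J17, mk_apply, e₁, e₂, e₃]) (by simp [eq_zero_iff, mul_J17, mk_apply, e₁, e₂, e₃])) 3
  simp [mul_J17, mk_apply, add_apply, e₁, e₂, e₃, zero_apply] at this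

theorem squareZeroEngel_J14 : SquareZeroEngel (TableAlgebra J14) := fun x hx y => by
  have hx' : x 0 * x 0 = 0 := by
    have := congrFun hx 3
    simp only [mul_J14, mk_apply, zero_apply] at this
    simpa [mul_comm] using this
  rw [mul_self_eq_zero] at hx'
  ext <;> simp [mul_J14, mk_apply, zero_apply, hx']

theorem not_squareZeroEngel_J16 : ¬ SquareZeroEngel (TableAlgebra J16) := fun h => by
  have := congrFun (h (mk J16 e₁) (by simp [eq_zero_iff, mul_J16, mk_apply, e₁, e₂, e₃]) (mk J16 e₂)) 3
  simp [mul_J16, mk_apply, add_apply, e₁, e₂, e₃, zero_apply] at this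

theorem engelRightAnnihilated_J17 : EngelRightAnnihilated (TableAlgebra J17) :=
    fun x hx hy y z => by
  have h0 : x 0 = 0 := by
    -- The last coordinate of x(x e₂) is x₀². Once x₀ = 0, the square of x forces x₁ = 0, so x lies
    -- in A².
    have := congrFun (hy (mk J17 e₂)) 3
    simpa [mul_J17, mk_apply, zero_apply, e₂] using this
  have h1 : x 1 = 0 := by
    have := congrFun hx 3
    simpa [mul_J17, mk_apply, zero_apply, h0] using this
  ext <;> simp [mul_J17, mk_apply, zero_apply, h0, h1]

theorem not_engelRightAnnihilated_J15 : ¬ EngelRightAnnihilated (TableAlgebra J15) := fun h => by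
  have := congrFun (h (mk J15 e₂) (by simp [eq_zero_iff, mul_J15, mk_apply, e₁, e₂, e₃])
    (fun y => by simp [eq_zero_iff, mul_J15, mk_apply, e₁, e₂, e₃]) (mk J15 e₁) (mk J15 e₁)) 3
  simp [mul_J15, mk_apply, add_apply, e₁, e₂, e₃, zero_apply] at this

end Separation

theorem not_isomorphic_kokorisTable_of_lt (i j : Fin 10) (hij : i < j) :
    ¬ Isomorphic (TableAlgebra (kokorisTable i)) (TableAlgebra (kokorisTable j)) := by
  intro h
  have h' := h.symm
  fin_cases i <;> fin_cases j <;> first | exact absurd hij (by decide) | skip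
  · exact not_isCommutative_J03 (h.isCommutative isCommutative_J01)
  · exact not_isCommutative_J04 (h.isCommutative isCommutative_J01)
  · exact not_squareZeroOfCubeZero_J06 (h.squareZeroOfCubeZero squareZeroOfCubeZero_J01)
  · exact not_cubesVanish_J01 (h'.cubesVanish cubesVanish_J13)
  · exact not_cubesVanish_J01 (h'.cubesVanish cubesVanish_J14)
  · exact not_cubesVanish_J01 (h'.cubesVanish cubesVanish_J15)
  · exact not_cubesVanish_J01 (h'.cubesVanish cubesVanish_J16)
  · exact not_cubesVanish_J01 (h'.cubesVanish cubesVanish_J17)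
  · exact not_squaresOfSquaresVanish_J18 (h.squaresOfSquaresVanish squaresOfSquaresVanish_J01)
  · exact not_squareZeroOfCubeZero_J03 (h'.squareZeroOfCubeZero squareZeroOfCubeZero_J04)
  · exact not_isCommutative_J03 (h'.isCommutative isCommutative_J06)
  · exact not_cubesVanish_J03 (h'.cubesVanish cubesVanish_J13)
  · exact not_cubesVanish_J03 (h'.cubesVanish cubesVanish_J14)
  · exact not_cubesVanish_J03 (h'.cubesVanish cubesVanish_J15)
  · exact not_cubesVanish_J03 (h'.cubesVanish cubesVanish_J16)
  · exact not_cubesVanish_J03 (h'.cubesVanish cubesVanish_J17)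
  · exact not_squaresOfSquaresVanish_J18 (h.squaresOfSquaresVanish squaresOfSquaresVanish_J03)
  · exact not_isCommutative_J04 (h'.isCommutative isCommutative_J06)
  · exact not_cubesVanish_J04 (h'.cubesVanish cubesVanish_J13)
  · exact not_cubesVanish_J04 (h'.cubesVanish cubesVanish_J14)
  · exact not_cubesVanish_J04 (h'.cubesVanish cubesVanish_J15)
  · exact not_cubesVanish_J04 (h'.cubesVanish cubesVanish_J16)
  · exact not_cubesVanish_J04 (h'.cubesVanish cubesVanish_J17)
  · exact not_squaresOfSquaresVanish_J18 (h.squaresOfSquaresVanish squaresOfSquaresVanish_J04)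
  · exact not_cubesVanish_J06 (h'.cubesVanish cubesVanish_J13)
  · exact not_cubesVanish_J06 (h'.cubesVanish cubesVanish_J14)
  · exact not_cubesVanish_J06 (h'.cubesVanish cubesVanish_J15)
  · exact not_cubesVanish_J06 (h'.cubesVanish cubesVanish_J16)
  · exact not_cubesVanish_J06 (h'.cubesVanish cubesVanish_J17)
  · exact not_squaresOfSquaresVanish_J18 (h.squaresOfSquaresVanish squaresOfSquaresVanish_J06)
  · exact not_isAlternating_J14 (h.isAlternating isAlternating_J13)
  · exact not_isAlternating_J15 (h.isAlternating isAlternating_J13)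
  · exact not_isAlternating_J16 (h.isAlternating isAlternating_J13)
  · exact not_isAlternating_J17 (h.isAlternating isAlternating_J13)
  · exact not_cubesVanish_J18 (h.cubesVanish cubesVanish_J13)
  · exact not_squareZeroAddClosed_J15 (h.squareZeroAddClosed squareZeroAddClosed_J14)
  · exact not_squareZeroEngel_J16 (h.squareZeroEngel squareZeroEngel_J14)
  · exact not_squareZeroAddClosed_J17 (h.squareZeroAddClosed squareZeroAddClosed_J14)
  · exact not_cubesVanish_J18 (h.cubesVanish cubesVanish_J14)
  · exact not_squareZeroAddClosed_J15 (h'.squareZeroAddClosed squareZeroAddClosed_J16)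
  · exact not_engelRightAnnihilated_J15 (h'.engelRightAnnihilated engelRightAnnihilated_J17)
  · exact not_cubesVanish_J18 (h.cubesVanish cubesVanish_J15)
  · exact not_squareZeroAddClosed_J17 (h.squareZeroAddClosed squareZeroAddClosed_J16)
  · exact not_cubesVanish_J18 (h.cubesVanish cubesVanish_J16)
  · exact not_cubesVanish_J18 (h.cubesVanish cubesVanish_J17)

theorem not_isomorphic_kokorisTable (i j : Fin 10) (hij : i ≠ j) :
    ¬ Isomorphic (TableAlgebra (kokorisTable i)) (TableAlgebra (kokorisTable j)) := by
  rcases lt_or_gt_of_ne hij with h | h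
  · exact not_isomorphic_kokorisTable_of_lt i j h
  · exact fun H => not_isomorphic_kokorisTable_of_lt j i h H.symm

theorem kokorisTable_spec (i : Fin 10) :
    Module.finrank ℂ (TableAlgebra (kokorisTable i)) = 4 ∧
      IsKokoris (TableAlgebra (kokorisTable i)) ∧
      IsNilpotentAlgebra (TableAlgebra (kokorisTable i)) ∧
      ¬ IsTwoStepNilpotent (TableAlgebra (kokorisTable i)) := by
  refine ⟨finrank_eq_four _, ?_⟩
  fin_cases i
  · exact ⟨isKokoris_J01, isNilpotentAlgebra_J01, not_isTwoStepNilpotent_J01⟩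
  · exact ⟨isKokoris_J03, isNilpotentAlgebra_J03, not_isTwoStepNilpotent_J03⟩
  · exact ⟨isKokoris_J04, isNilpotentAlgebra_J04, not_isTwoStepNilpotent_J04⟩
  · exact ⟨isKokoris_J06, isNilpotentAlgebra_J06, not_isTwoStepNilpotent_J06⟩
  · exact ⟨isKokoris_J13, isNilpotentAlgebra_J13, not_isTwoStepNilpotent_J13⟩
  · exact ⟨isKokoris_J14, isNilpotentAlgebra_J14, not_isTwoStepNilpotent_J14⟩
  · exact ⟨isKokoris_J15, isNilpotentAlgebra_J15, not_isTwoStepNilpotent_J15⟩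
  · exact ⟨isKokoris_J16, isNilpotentAlgebra_J16, not_isTwoStepNilpotent_J16⟩
  · exact ⟨isKokoris_J17, isNilpotentAlgebra_J17, not_isTwoStepNilpotent_J17⟩
  · exact ⟨isKokoris_J18, isNilpotentAlgebra_J18, not_isTwoStepNilpotent_J18⟩

/-! ### Generation and dimension -/

section Generation

variable {A : Type u} [NonUnitalNonAssocRing A] [Module ℂ A]
  [IsScalarTower ℂ A A] [SMulCommClass ℂ A A]

/-- The table makes the span of `v` a subalgebra, so spanning modulo A² is enough; linear
independence of `v` then comes for free from the dimension. -/
theorem isomorphic_of_generates (hdim : Module.finrank ℂ A = 4) (hn : IsNilpotentAlgebra A)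
    (T : Table) (v : Fin 4 → A) (hgen : Submodule.span ℂ (Set.range v) ⊔ powSucc A 1 = ⊤)
    (hmul : ∀ i j, v i * v j = ∑ k, T i j k • v k) : Isomorphic A (TableAlgebra T) := by
  refine isomorphic_of_span hdim T v (hn.eq_top (fun x hx y hy => ?_) hgen).ge hmul
  have h : Submodule.map₂ (LinearMap.mul ℂ A) (Submodule.span ℂ (Set.range v))
      (Submodule.span ℂ (Set.range v)) ≤ Submodule.span ℂ (Set.range v) := by
    rw [Submodule.map₂_span_span, Submodule.span_le]
    rintro _ ⟨_, ⟨i, rfl⟩, _, ⟨j, rfl⟩, rfl⟩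
    change v i * v j ∈ _
    rw [hmul]
    exact sum_mem fun k _ => Submodule.smul_mem _ _ (Submodule.subset_span ⟨k, rfl⟩)
  exact h (Submodule.apply_mem_map₂ (LinearMap.mul ℂ A) hx hy)

theorem mul_table_of_entries {A : Type*} [NonUnitalNonAssocRing A] [Module ℂ A] {T : Table}
    {v : Fin 4 → A}
    (h : ∀ i j, v i * v j = T i j 0 • v 0 + T i j 1 • v 1 + T i j 2 • v 2 + T i j 3 • v 3)
    (i j : Fin 4) : v i * v j = ∑ k, T i j k • v k := by
  rw [h, Fin.sum_univ_four]

theorem finrank_lt_finrank_sup_span {V : Type*} [AddCommGroup V] [Module ℂ V]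
    [FiniteDimensional ℂ V] {S : Submodule ℂ V} {x : V} (hx : x ∉ S) :
    Module.finrank ℂ S < Module.finrank ℂ ↥(S ⊔ Submodule.span ℂ {x}) := by
  refine Submodule.finrank_lt_finrank_of_lt (lt_of_le_of_ne le_sup_left fun h => hx ?_)
  rw [h]
  exact Submodule.mem_sup_right (Submodule.mem_span_singleton_self x)

theorem exists_sub_smul_mem_of_finrank {V : Type*} [AddCommGroup V] [Module ℂ V]
    [FiniteDimensional ℂ V] {S R : Submodule ℂ V} (hSR : S ≤ R)
    (hd : Module.finrank ℂ R ≤ Module.finrank ℂ S + 1) {z : V} (hz : z ∈ R) (hzS : z ∉ S)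
    {y : V} (hy : y ∈ R) : ∃ c : ℂ, y - c • z ∈ S := by
  have h : S ⊔ Submodule.span ℂ {z} = R := by
    refine Submodule.eq_of_le_of_finrank_le (sup_le hSR (by simpa using hz)) ?_
    have := finrank_lt_finrank_sup_span hzS
    omega
  rw [← h] at hy
  obtain ⟨s, hs, t, ht, rfl⟩ := Submodule.mem_sup.1 hy
  obtain ⟨c, rfl⟩ := Submodule.mem_span_singleton.1 ht
  exact ⟨c, by simpa using hs⟩

theorem exists_sup_span_pair_eq_top {V : Type*} [AddCommGroup V] [Module ℂ V]
    [FiniteDimensional ℂ V] {S : Submodule ℂ V}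
    (hd : Module.finrank ℂ V ≤ Module.finrank ℂ S + 2) {x : V} (hx : x ∉ S) :
    ∃ y : V, ∀ t, ∃ a b : ℂ, t - a • x - b • y ∈ S := by
  have h1 := finrank_lt_finrank_sup_span hx
  obtain ⟨y, hy⟩ : ∃ y, S ⊔ Submodule.span ℂ {x} ⊔ Submodule.span ℂ {y} = ⊤ := by
    by_cases htop : S ⊔ Submodule.span ℂ {x} = ⊤
    · exact ⟨0, by simp [htop]⟩
    · obtain ⟨y, hy⟩ : ∃ y, y ∉ S ⊔ Submodule.span ℂ {x} := by
        by_contra! h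
        exact htop (eq_top_iff.2 fun t _ => h t)
      have h2 := finrank_lt_finrank_sup_span hy
      refine ⟨y, Submodule.eq_top_of_finrank_eq (le_antisymm (Submodule.finrank_le _) ?_)⟩
      omega
  refine ⟨y, fun t => ?_⟩
  obtain ⟨s, hs, r, hr, rfl⟩ := Submodule.mem_sup.1 (hy ▸ Submodule.mem_top : t ∈ _)
  obtain ⟨s, hs, q, hq, rfl⟩ := Submodule.mem_sup.1 hs
  obtain ⟨b, rfl⟩ := Submodule.mem_span_singleton.1 hr
  obtain ⟨a, rfl⟩ := Submodule.mem_span_singleton.1 hq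
  refine ⟨a, b, ?_⟩
  have : s + a • x + b • y - a • x - b • y = s := by abel
  rwa [this]

/-- Cayley–Hamilton: the characteristic polynomial of a nilpotent operator in dimension 4 is X⁴. -/
theorem IsNilpotentAlgebra.pow_four_mulLeft (h : IsNilpotentAlgebra A)
    (hdim : Module.finrank ℂ A = 4) (x y : A) : x * (x * (x * (x * y))) = 0 := by
  have : FiniteDimensional ℂ A := .of_finrank_pos (by omega)
  have h1 := (h.isNilpotent_mulLeft x).charpoly_eq_X_pow_finrank
  have h2 := LinearMap.aeval_self_charpoly (LinearMap.mulLeft ℂ x)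
  rw [h1, hdim, map_pow, Polynomial.aeval_X] at h2
  have h3 := LinearMap.congr_fun h2 y
  simpa [pow_succ, Module.End.mul_apply] using h3

/-- A square of dimension at most one forces the cube to vanish. -/
theorem IsNilpotentAlgebra.isTwoStepNilpotent_of_finrank_le_one [FiniteDimensional ℂ A]
    (h : IsNilpotentAlgebra A) (hd : Module.finrank ℂ (powSucc A 1) ≤ 1) :
    IsTwoStepNilpotent A := by
  by_cases hb : powSucc A 1 = ⊥
  · exact le_bot_iff.1 (powSucc_two_le_one.trans hb.le)
  by_contra h2
  have h21 : powSucc A 2 ≠ powSucc A 1 := fun e => hb (h.powSucc_one_eq_bot e)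
  have hlt := Submodule.finrank_lt_finrank_of_lt (lt_of_le_of_ne powSucc_two_le_one h21)
  exact h2 (Submodule.finrank_eq_zero.1 (by omega))

end Generation

/-! ### One generator -/

section OneGenerator

variable {A : Type u} [NonUnitalNonAssocRing A] [Module ℂ A]
  [IsScalarTower ℂ A A] [SMulCommClass ℂ A A]

theorem IsKokoris.br_eq_zero_of_br_eq_zero (h : IsKokoris A) {t x y : A} (hx : br t x = 0)
    (hy : br t y = 0) : br t (circ x y) = 0 := by
  rw [h.leibniz, hx, hy, zero_circ, circ_zero, add_zero]

theorem IsKokoris.isomorphic_J18 (h : IsKokoris A) (hdim : Module.finrank ℂ A = 4)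
    (hn : IsNilpotentAlgebra A) {x : A} (hgen : powSucc A 1 ⊔ Submodule.span ℂ {x} = ⊤) :
    Isomorphic A (TableAlgebra J18) := by
  obtain ⟨p, hp⟩ : ∃ p, circ x x = p := ⟨_, rfl⟩
  obtain ⟨q, hq⟩ : ∃ q, circ x p = q := ⟨_, rfl⟩
  obtain ⟨r, hr⟩ : ∃ r, circ x q = r := ⟨_, rfl⟩
  -- Whatever commutes with x commutes with its powers. Applied to x and then to the powers
  -- themselves, this kills all brackets among x, x², x³, x⁴.
  have key : ∀ t, br t x = 0 → br t p = 0 ∧ br t q = 0 ∧ br t r = 0 := by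
    intro t ht
    have hp' : br t p = 0 := hp ▸ h.br_eq_zero_of_br_eq_zero ht ht
    have hq' : br t q = 0 := hq ▸ h.br_eq_zero_of_br_eq_zero ht hp'
    exact ⟨hp', hq', hr ▸ h.br_eq_zero_of_br_eq_zero ht hq'⟩
  obtain ⟨xp, xq, xr⟩ := key x (br_self x)
  obtain ⟨-, pq, pr⟩ := key p (br_eq_zero_symm xp)
  obtain ⟨qp, -, qr⟩ := key q (br_eq_zero_symm xq)
  obtain ⟨rp, rq, -⟩ := key r (br_eq_zero_symm xr)
  have hxr : circ x r = 0 := by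
    have := hn.pow_four_mulLeft hdim x x
    rwa [← circ_self, hp, mul_eq_circ xp, hq, mul_eq_circ xq, hr, mul_eq_circ xr] at this
  -- Associativity turns multiplication by a power of x into iterated multiplication by x, and x⁵ =
  -- 0.
  have cp : ∀ t, circ p t = circ x (circ x t) := fun t => by rw [← hp, h.circ_assoc]
  have cq : ∀ t, circ q t = circ x (circ p t) := fun t => by rw [← hq, h.circ_assoc]
  have cr : ∀ t, circ r t = circ x (circ q t) := fun t => by rw [← hr, h.circ_assoc]
  refine isomorphic_of_generates hdim hn J18 ![x, p, q, r] ?_ (mul_table_of_entries fun i j => ?_)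
  · rw [eq_top_iff, ← hgen, sup_comm]
    refine sup_le_sup_right ?_ _
    rw [Submodule.span_singleton_le_iff_mem]
    exact Submodule.subset_span ⟨0, rfl⟩
  · fin_cases i <;> fin_cases j <;>
      simp [J18, e₂, e₃, e₄, mul_eq_circ, *, -circ_self, br_eq_zero_symm]

end OneGenerator

/-! ### The case dim A² = 2: common structure -/

section TwoGenerators

variable {A : Type u} [NonUnitalNonAssocRing A] [Module ℂ A]
  [IsScalarTower ℂ A A] [SMulCommClass ℂ A A]

variable (A) in
/-- `A / A²` is at most two-dimensional, `A² / A³` and `A³` are lines, and `A³` annihilates `A`. -/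
structure HasTwoGeneratorShape : Prop where
  eq_smul : ∀ u ∈ powSucc A 2, u ≠ 0 → ∀ y ∈ powSucc A 2, ∃ d : ℂ, y = d • u
  sub_smul_mem : ∀ z ∈ powSucc A 1, z ∉ powSucc A 2 → ∀ y ∈ powSucc A 1,
    ∃ c : ℂ, y - c • z ∈ powSucc A 2
  annihilates : ∀ u ∈ powSucc A 2, ∀ x, x * u = 0 ∧ u * x = 0
  generates : ∀ x ∉ powSucc A 1, ∃ y, ∀ t, ∃ a b : ℂ, t - a • x - b • y ∈ powSucc A 1

theorem IsNilpotentAlgebra.hasTwoGeneratorShape (hn : IsNilpotentAlgebra A)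
    (hdim : Module.finrank ℂ A = 4) (hd : Module.finrank ℂ (powSucc A 1) = 2)
    (h2 : ¬ IsTwoStepNilpotent A) : HasTwoGeneratorShape A := by
  have : FiniteDimensional ℂ A := .of_finrank_pos (by omega)
  have h1 : powSucc A 1 ≠ ⊥ := fun e => by
    rw [e, finrank_bot] at hd
    omega
  -- A³ is nonzero and strictly inside the plane A², hence a line.
  have hlt := Submodule.finrank_lt_finrank_of_lt
    (lt_of_le_of_ne powSucc_two_le_one fun e => h1 (hn.powSucc_one_eq_bot e))
  have hpos : Module.finrank ℂ (powSucc A 2) ≠ 0 := fun e => h2 (Submodule.finrank_eq_zero.1 e)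
  have hline : ∀ u ∈ powSucc A 2, u ≠ 0 → Submodule.span ℂ {u} = powSucc A 2 := by
    intro u hu hu0
    refine Submodule.eq_of_le_of_finrank_le (by simpa using hu) ?_
    rw [finrank_span_singleton hu0]
    omega
  refine ⟨fun u hu hu0 y hy => ?_, fun z hz hz2 y hy => ?_, fun u hu x => ?_, fun x hx => ?_⟩
  · rw [← hline u hu hu0] at hy
    obtain ⟨d, rfl⟩ := Submodule.mem_span_singleton.1 hy
    exact ⟨d, rfl⟩
  · exact exists_sub_smul_mem_of_finrank powSucc_two_le_one (by omega) hz hz2 hy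
  · by_cases hu0 : u = 0
    · simp [hu0]
    refine hn.annihilates_of_line (fun x => ?_) (fun x => ?_) x
    · rw [hline u hu hu0]
      exact mul_mem_powSucc_succ x (powSucc_two_le_one hu)
    · rw [hline u hu hu0]
      exact mul_mem_powSucc_succ' x (powSucc_two_le_one hu)
  · exact exists_sup_span_pair_eq_top (by omega) hx

theorem circ_mem_powSucc_one (x y : A) : circ x y ∈ powSucc A 1 :=
  Submodule.smul_mem _ _ (add_mem (mul_mem_powSucc_one _ _) (mul_mem_powSucc_one _ _))

theorem br_mem_powSucc_one (x y : A) : br x y ∈ powSucc A 1 :=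
  Submodule.smul_mem _ _ (sub_mem (mul_mem_powSucc_one _ _) (mul_mem_powSucc_one _ _))

theorem circ_mem_powSucc_two (x : A) {y : A} (hy : y ∈ powSucc A 1) : circ x y ∈ powSucc A 2 :=
  Submodule.smul_mem _ _ (add_mem (mul_mem_powSucc_succ x hy) (mul_mem_powSucc_succ' x hy))

theorem br_mem_powSucc_two (x : A) {y : A} (hy : y ∈ powSucc A 1) : br x y ∈ powSucc A 2 :=
  Submodule.smul_mem _ _ (sub_mem (mul_mem_powSucc_succ x hy) (mul_mem_powSucc_succ' x hy))

namespace HasTwoGeneratorShape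

variable (hs : HasTwoGeneratorShape A)
include hs

theorem circ_eq_zero {u : A} (hu : u ∈ powSucc A 2) (x : A) : circ x u = 0 := by
  simp [circ, hs.annihilates u hu x]

theorem circ_eq_zero' {u : A} (hu : u ∈ powSucc A 2) (x : A) : circ u x = 0 := by
  simp [circ, hs.annihilates u hu x]

theorem br_eq_zero {u : A} (hu : u ∈ powSucc A 2) (x : A) : br x u = 0 := by
  simp [br, hs.annihilates u hu x]

theorem br_eq_zero' {u : A} (hu : u ∈ powSucc A 2) (x : A) : br u x = 0 := by
  simp [br, hs.annihilates u hu x]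

theorem exists_eq_smul_add {z : A} (hz : z ∈ powSucc A 1) (hz2 : z ∉ powSucc A 2) {y : A}
    (hy : y ∈ powSucc A 1) : ∃ (c : ℂ), ∃ u ∈ powSucc A 2, y = c • z + u := by
  obtain ⟨c, hc⟩ := hs.sub_smul_mem z hz hz2 y hy
  exact ⟨c, _, hc, by abel⟩

end HasTwoGeneratorShape

/-! ### Two generators, nonzero cubes -/

/-- With p = x² and w = x³, multiplication by x sends p to w ≠ 0. This detects, and so excludes, any
p-component of the products involving y. -/
theorem IsKokoris.exists_basis_of_cube_ne_zero (h : IsKokoris A) (hs : HasTwoGeneratorShape A)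
    {x : A} (hx : x * (x * x) ≠ 0) :
    ∃ (y : A) (δ γ : ℂ), (∀ t, ∃ a b : ℂ, t - a • x - b • y ∈ powSucc A 1) ∧
      x * y = δ • (x * (x * x)) ∧ y * x = -(δ • (x * (x * x))) ∧
      y * y = γ • (x * (x * x)) ∧ y * (x * x) = 0 ∧ (x * x) * y = 0 ∧ (x * x) * (x * x) = 0 := by
  obtain ⟨p, hp⟩ : ∃ p, circ x x = p := ⟨_, rfl⟩
  obtain ⟨w, hw⟩ : ∃ w, circ x p = w := ⟨_, rfl⟩
  have hxp : br x p = 0 := hp ▸ h.br_eq_zero_of_br_eq_zero (br_self x) (br_self x)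
  rw [← circ_self, hp, mul_eq_circ hxp, hw] at hx ⊢
  have hp1 : p ∈ powSucc A 1 := hp ▸ circ_mem_powSucc_one x x
  have hw2 : w ∈ powSucc A 2 := hw ▸ circ_mem_powSucc_two x hp1
  have hp2 : p ∉ powSucc A 2 := fun hp2 => hx (hw ▸ hs.circ_eq_zero hp2 x)
  have hx1 : x ∉ powSucc A 1 := fun hx1 => hp2 (hp ▸ circ_mem_powSucc_two x hx1)
  obtain ⟨y, hy⟩ := hs.generates x hx1
  obtain ⟨σ, u, hu, hσ⟩ := hs.exists_eq_smul_add hp1 hp2 (circ_mem_powSucc_one x y)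
  obtain ⟨β, hβ⟩ := hs.eq_smul w hw2 hx u hu
  -- Since `circ x y = σ • p + β • w`, while `circ x x = p` and `circ x p = w`, this correction
  -- gives `circ x z = 0`.
  obtain ⟨z, hz⟩ : ∃ z, y - σ • x - β • p = z := ⟨_, rfl⟩
  have hyz : y = z + σ • x + β • p := by rw [← hz]; abel
  have hgen : ∀ t, ∃ a b : ℂ, t - a • x - b • z ∈ powSucc A 1 := by
    intro t
    obtain ⟨a, b, hab⟩ := hy t
    refine ⟨a + b * σ, b, ?_⟩
    have : t - (a + b * σ) • x - b • z = t - a • x - b • y + (b * β) • p := by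
      rw [hyz]; module
    rw [this]
    exact add_mem hab (Submodule.smul_mem _ _ hp1)
  have hxz : circ x z = 0 := by
    have : circ x y = circ x z + σ • p + β • w := by
      rw [hyz, circ_add, circ_add, circ_smul, circ_smul, hp, hw]
    rw [hσ, hβ] at this
    linear_combination (norm := module) -this
  obtain ⟨ω, u', hu', hω⟩ := hs.exists_eq_smul_add hp1 hp2 (br_mem_powSucc_one x z)
  -- Leibniz: 0 = `br x (circ x z)` = `circ x (br x z)` = ω w.
  have hω0 : ω = 0 := by
    have := h.leibniz x x z
    rw [hxz, br_zero, br_self, zero_circ, zero_add, hω, circ_add, circ_smul, hw,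
      hs.circ_eq_zero hu', add_zero] at this
    exact (smul_eq_zero.1 this.symm).resolve_right hx
  rw [hω0, zero_smul, zero_add] at hω
  obtain ⟨δ, hδ⟩ := hs.eq_smul w hw2 hx u' hu'
  obtain ⟨τ, u'', hu'', hτ⟩ := hs.exists_eq_smul_add hp1 hp2 (circ_mem_powSucc_one z z)
  -- Associativity: 0 = `circ (circ x z) z` = `circ x (circ z z)` = τ w.
  have hτ0 : τ = 0 := by
    have := h.circ_assoc x z z
    rw [hxz, zero_circ, hτ, circ_add, circ_smul, hw, hs.circ_eq_zero hu'', add_zero] at this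
    exact (smul_eq_zero.1 this.symm).resolve_right hx
  rw [hτ0, zero_smul, zero_add] at hτ
  obtain ⟨γ, hγ⟩ := hs.eq_smul w hw2 hx u'' hu''
  have hzx : circ z x = 0 := by rw [circ_comm, hxz]
  have hpz : circ p z = 0 := by rw [← hp, h.circ_assoc, hxz, circ_zero]
  have hbzp : br z p = 0 := by
    rw [← hp, h.leibniz, br_antisymm z x, hω, neg_circ, hs.circ_eq_zero' hu', circ_neg,
      hs.circ_eq_zero hu', neg_zero, add_zero]
  refine ⟨z, δ, γ, hgen, ?_, ?_, ?_, ?_, ?_, ?_⟩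
  · rw [mul_eq_circ_add_br, hxz, zero_add, hω, hδ]
  · rw [mul_eq_circ_add_br, hzx, zero_add, br_antisymm, hω, hδ]
  · rw [← circ_self, hτ, hγ]
  · rw [mul_eq_circ hbzp, circ_comm, hpz]
  · rw [mul_eq_circ (br_eq_zero_symm hbzp), hpz]
  · rw [← circ_self]
    nth_rw 1 [← hp]
    rw [h.circ_assoc, hw, hs.circ_eq_zero hw2]

/-- Base change x ↦ ax, y ↦ c(y − d x²). The shift by d moves both mixed products by the same
amount, so it can place the antisymmetric part δ entirely in yx; `h1`, `h2`, `h3` compare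
coefficients of the new fourth vector a³x³. -/
theorem isomorphic_cubic_table (hdim : Module.finrank ℂ A = 4) (hn : IsNilpotentAlgebra A)
    (hs : HasTwoGeneratorShape A) {x y : A} {δ γ a c d p q r : ℂ} (ha : a ≠ 0) (hc : c ≠ 0)
    (hgen : ∀ t, ∃ a b : ℂ, t - a • x - b • y ∈ powSucc A 1)
    (hxy : x * y = δ • (x * (x * x))) (hyx : y * x = -(δ • (x * (x * x))))
    (hyy : y * y = γ • (x * (x * x))) (hyp : y * (x * x) = 0) (hpy : (x * x) * y = 0)
    (hpp : (x * x) * (x * x) = 0) (hpx : (x * x) * x = x * (x * x))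
    (h1 : a * c * (δ - d) = p * a ^ 3) (h2 : a * c * (-δ - d) = q * a ^ 3)
    (h3 : c ^ 2 * γ = r * a ^ 3) {T : Table}
    (hT : T = !![e₂, e₄, p • e₄, 0; e₄, 0, 0, 0; q • e₄, 0, r • e₄, 0; 0, 0, 0, 0]) :
    Isomorphic A (TableAlgebra T) := by
  subst hT
  obtain ⟨e, he⟩ : ∃ e, x * x = e := ⟨_, rfl⟩
  obtain ⟨w, hw⟩ : ∃ w, x * e = w := ⟨_, rfl⟩
  simp only [he, hw] at hxy hyx hyy hyp hpy hpp hpx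
  have he1 : e ∈ powSucc A 1 := he ▸ mul_mem_powSucc_one x x
  have hw2 : w ∈ powSucc A 2 := hw ▸ mul_mem_powSucc_succ x he1
  have hl : ∀ t, t * w = 0 := fun t => (hs.annihilates w hw2 t).1
  have hr : ∀ t, w * t = 0 := fun t => (hs.annihilates w hw2 t).2
  refine isomorphic_of_generates hdim hn _ ![a • x, a ^ 2 • e, c • (y - d • e), a ^ 3 • w] ?_
    (mul_table_of_entries fun i j => ?_)
  · refine eq_top_iff.2 fun t _ => ?_
    obtain ⟨k, l, hkl⟩ := hgen t
    have : t = (k / a) • (a • x) + (l / c) • (c • (y - d • e)) +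
        ((t - k • x - l • y) + (l * d) • e) := by
      match_scalars <;> field_simp <;> ring
    rw [this]
    refine add_mem (Submodule.mem_sup_left (add_mem ?_ ?_)) (Submodule.mem_sup_right ?_)
    · exact Submodule.smul_mem _ _ (Submodule.subset_span ⟨0, rfl⟩)
    · exact Submodule.smul_mem _ _ (Submodule.subset_span ⟨2, rfl⟩)
    · exact add_mem hkl (Submodule.smul_mem _ _ he1)
  · fin_cases i <;> fin_cases j <;>
      simp [e₂, e₄, smul_mul_assoc, mul_smul_comm, mul_sub, sub_mul, *]
    · module
    · module
    · match_scalars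
      linear_combination h1
    · module
    · match_scalars
      linear_combination h2
    · match_scalars
      linear_combination h3

theorem IsKokoris.exists_isomorphic_of_cube_ne_zero (h : IsKokoris A)
    (hdim : Module.finrank ℂ A = 4) (hn : IsNilpotentAlgebra A) (hs : HasTwoGeneratorShape A)
    {x : A} (hx : x * (x * x) ≠ 0) :
    ∃ i, Isomorphic A (TableAlgebra (kokorisTable i)) := by
  obtain ⟨y, δ, γ, hgen, hxy, hyx, hyy, hyp, hpy, hpp⟩ := h.exists_basis_of_cube_ne_zero hs hx
  have key := fun {a c : ℂ} (d p q r : ℂ) (ha : a ≠ 0) (hc : c ≠ 0) =>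
    isomorphic_cubic_table (d := d) (p := p) (q := q) (r := r) hdim hn hs ha hc hgen hxy hyx hyy
      hyp hpy hpp (h.mul_self_mul x)
  by_cases hγ : γ = 0
  · subst hγ
    by_cases hδ : δ = 0
    · subst hδ
      refine ⟨0, isomorphic_of_generates hdim hn J01 ![x, x * x, x * (x * x), y] ?_
        (mul_table_of_entries fun i j => ?_)⟩
      · refine eq_top_iff.2 fun t _ => ?_
        obtain ⟨k, l, hkl⟩ := hgen t
        have : t = k • x + l • y + (t - k • x - l • y) := by abel
        rw [this]
        refine add_mem (Submodule.mem_sup_left (add_mem ?_ ?_)) (Submodule.mem_sup_right hkl)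
        · exact Submodule.smul_mem _ _ (Submodule.subset_span ⟨0, rfl⟩)
        · exact Submodule.smul_mem _ _ (Submodule.subset_span ⟨3, rfl⟩)
      · have hw := hs.annihilates _ (mul_mem_powSucc_succ x (mul_mem_powSucc_one x x))
        have hpx := h.mul_self_mul x
        obtain ⟨w, hw0⟩ : ∃ w, x * (x * x) = w := ⟨_, rfl⟩
        rw [hw0] at hw hpx hxy hyx hyy ⊢
        fin_cases i <;> fin_cases j <;> simp [J01, e₂, e₃, *]
    · exact ⟨2, key (a := 1) (c := -1 / (2 * δ)) δ 0 1 0 one_ne_zero (by simp [hδ])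
        (by ring) (by field_simp; ring) (by ring) (T := J04)
        (by simp [J04])⟩
  · by_cases hδ : δ = 0
    · subst hδ
      obtain ⟨c, hc⟩ := IsAlgClosed.exists_pow_nat_eq γ two_pos
      have hc0 : c ≠ 0 := by
        rintro rfl
        exact hγ (by simpa using hc.symm)
      exact ⟨3, key (a := 1) (c := 1 / c) 0 0 0 1 one_ne_zero (by simp [hc0])
        (by ring) (by ring) (by rw [← hc]; field_simp) (T := J06)
        (by simp [J06])⟩
    -- With d = δ the conditions are −2δc = a² and c²γ = a³; eliminating c gives a = 4δ²/γ.
    · exact ⟨1, key (a := 4 * δ ^ 2 / γ) (c := -(4 * δ ^ 2 / γ) ^ 2 / (2 * δ)) δ 0 1 1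
        (by simp [hδ, hγ]) (by simp [hδ, hγ]) (by ring) (by field_simp; ring) (by field_simp; ring) (T := J03)
        (by simp [J03])⟩

end TwoGenerators

/-! ### Two generators, vanishing cubes -/

section VanishingCubes

variable {A : Type u} [NonUnitalNonAssocRing A] [Module ℂ A]
  [IsScalarTower ℂ A A] [SMulCommClass ℂ A A]

/-- Polarization of the cubic form of a commutative associative product: the part of (x + y)³ − (x −
y)³ linear in y is 6x²y, and linearizing x² in x finishes. -/
theorem IsKokoris.circ_circ_eq_zero (h : IsKokoris A) (h3 : ∀ x : A, x * (x * x) = 0)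
    (x y z : A) : circ x (circ y z) = 0 := by
  have cube : ∀ x : A, circ x (circ x x) = 0 := fun x => by
    rw [← mul_eq_circ (h.br_eq_zero_of_br_eq_zero (br_self x) (br_self x)), circ_self, h3]
  have comm : ∀ x y : A, circ x (circ x y) = circ y (circ x x) := fun x y => by
    rw [← h.circ_assoc, circ_comm]
  have sq : ∀ x y : A, circ y (circ x x) = 0 := by
    intro x y
    have h1 := cube (x + y)
    have h2 := cube (x + -y)
    simp only [circ_add, add_circ, circ_neg, neg_circ, cube, circ_comm y x] at h1 h2
    linear_combination (norm := module) (1 / 6 : ℂ) • h1 - (1 / 6 : ℂ) • h2 - (2 / 3 : ℂ) • comm x y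
  have h1 := sq (y + z) x
  simp only [circ_add, add_circ, sq, circ_comm z y] at h1
  linear_combination (norm := module) (1 / 2 : ℂ) • h1

theorem IsKokoris.exists_basis_of_cubes_eq_zero (h : IsKokoris A) (hs : HasTwoGeneratorShape A)
    (h2 : ¬ IsTwoStepNilpotent A) (h3 : ∀ x : A, x * (x * x) = 0) :
    ∃ (x y z w : A) (α β γ : ℂ), (∀ t, ∃ a b : ℂ, t - a • x - b • y ∈ powSucc A 1) ∧
      w ∈ powSucc A 2 ∧
      x * x = α • w ∧ x * y = z + β • w ∧ y * x = -z + β • w ∧ y * y = γ • w ∧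
      x * z = w ∧ z * x = -w ∧ y * z = 0 ∧ z * y = 0 ∧ z * z = 0 := by
  have h3' := h.circ_circ_eq_zero h3
  have not_annih : ¬ ∀ y ∈ powSucc A 1, ∀ x, x * y = 0 ∧ y * x = 0 := by
    intro H
    refine h2 (le_bot_iff.1 (powSucc_two_le fun x y hy => ?_))
    exact ⟨(Submodule.mem_bot ℂ).2 (H y hy x).1, (Submodule.mem_bot ℂ).2 (H y hy x).2⟩
  -- If all brackets lay in A³, they would annihilate A. Leibniz then gives `br x (circ s t) = 0`,
  -- and with the vanishing triple products all of A² annihilates A.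
  have hab : ∃ a b : A, br a b ∉ powSucc A 2 := by
    by_contra! H
    have key : ∀ s t x : A, x * (s * t) = 0 ∧ (s * t) * x = 0 := by
      intro s t x
      have hb : br x (circ s t) = 0 := by
        rw [h.leibniz, hs.circ_eq_zero' (H x s), hs.circ_eq_zero (H x t), add_zero]
      have hst := hs.annihilates _ (H s t) x
      rw [mul_eq_circ_add_br s t, mul_add, add_mul, hst.1, hst.2, mul_eq_circ hb,
        mul_eq_circ (br_eq_zero_symm hb), circ_comm _ x, h3']
      simp
    refine not_annih fun y hy => ?_
    let S : Submodule ℂ A :=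
      { carrier := {y | ∀ x, x * y = 0 ∧ y * x = 0}
        zero_mem' := fun x => by simp
        add_mem' := fun {y z} hy hz x => by simp [mul_add, add_mul, hy x, hz x]
        smul_mem' := fun c y hy x => by simp [mul_smul_comm, smul_mul_assoc, hy x] }
    have hS : powSucc A 1 ≤ S := powSucc_succ_le fun _ _ _ s _ t _ => key s t
    exact hS hy
  obtain ⟨a, b, hab⟩ := hab
  obtain ⟨z, hz⟩ : ∃ z, br a b = z := ⟨_, rfl⟩
  have hz1 : z ∈ powSucc A 1 := hz ▸ br_mem_powSucc_one a b
  rw [hz] at hab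
  have dec := fun {y : A} => hs.exists_eq_smul_add hz1 hab (y := y)
  -- If `circ x z ≠ 0`, vanishing triple products force all `circ` products into A³. Then `br b
  -- (circ a b) = 0` yields `circ z b = 0`, after which `br a (circ x b) = 0` reduces to `circ x z =
  -- 0`.
  have hcz : ∀ x, circ x z = 0 := by
    intro x
    by_contra hx
    have hc2 : ∀ s t : A, circ s t ∈ powSucc A 2 := by
      intro s t
      obtain ⟨k, u, hu, hk⟩ := dec (circ_mem_powSucc_one s t)
      have := h3' x s t
      rw [hk, circ_add, circ_smul, hs.circ_eq_zero hu, add_zero] at this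
      rw [hk, (smul_eq_zero.1 this).resolve_right hx, zero_smul, zero_add]
      exact hu
    have hb : circ z b = 0 := by
      have := h.leibniz b a b
      rw [hs.br_eq_zero (hc2 a b), br_self, circ_zero, add_zero, br_antisymm, hz, neg_circ] at this
      exact neg_eq_zero.1 this.symm
    have h1 := h.leibniz a x b
    obtain ⟨k, u, hu, hk⟩ := dec (br_mem_powSucc_one a x)
    rw [hs.br_eq_zero (hc2 x b), hk, add_circ, smul_circ, hb, hs.circ_eq_zero' hu, hz] at h1
    exact hx (by simpa using h1.symm)
  have hc1 : ∀ x, ∀ y ∈ powSucc A 1, circ x y = 0 := by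
    intro x y hy
    obtain ⟨k, u, hu, rfl⟩ := dec hy
    rw [circ_add, circ_smul, hcz, hs.circ_eq_zero hu, smul_zero, add_zero]
  obtain ⟨t, ht⟩ : ∃ t, br t z ≠ 0 := by
    by_contra! H
    refine not_annih fun y hy x => ?_
    have hb : br x y = 0 := by
      obtain ⟨k, u, hu, rfl⟩ := dec hy
      rw [br_add, br_smul, H, hs.br_eq_zero hu, smul_zero, add_zero]
    rw [mul_eq_circ hb, mul_eq_circ (br_eq_zero_symm hb), circ_comm y, hc1 x y hy]
    simp
  -- By Leibniz `br t` kills every `circ` product, while it does not kill z.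
  have hc2 : ∀ x y : A, circ x y ∈ powSucc A 2 := by
    intro x y
    obtain ⟨k, u, hu, hk⟩ := dec (circ_mem_powSucc_one x y)
    have := h.leibniz t x y
    rw [hc1 x _ (br_mem_powSucc_one t y), circ_comm (br t x), hc1 y _ (br_mem_powSucc_one t x), hk,
      br_add, br_smul, hs.br_eq_zero hu, add_zero, add_zero] at this
    rw [hk, (smul_eq_zero.1 this).resolve_right ht, zero_smul, zero_add]
    exact hu
  have hbz2 : ∀ x, br x z ∈ powSucc A 2 := fun x => br_mem_powSucc_two x hz1
  have ht1 : t ∉ powSucc A 1 := by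
    intro ht1
    obtain ⟨k, u, hu, rfl⟩ := dec ht1
    exact ht (by rw [add_br, smul_br, br_self, hs.br_eq_zero' hu, smul_zero, add_zero])
  obtain ⟨y, hy⟩ := hs.generates t ht1
  obtain ⟨d, hd⟩ := hs.eq_smul _ (hbz2 t) ht _ (hbz2 y)
  -- The second generator is moved into the centralizer of z.
  obtain ⟨s, hsy⟩ : ∃ s, y - d • t = s := ⟨_, rfl⟩
  have hys : y = s + d • t := by rw [← hsy]; abel
  have hgen : ∀ r, ∃ a b : ℂ, r - a • t - b • s ∈ powSucc A 1 := by
    intro r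
    obtain ⟨a, b, hr⟩ := hy r
    refine ⟨a + b * d, b, ?_⟩
    have : r - (a + b * d) • t - b • s = r - a • t - b • y := by rw [hys]; module
    rwa [this]
  have hsz : br s z = 0 := by
    rw [hys, add_br, smul_br] at hd
    simpa using hd
  -- Modulo A³, `br a b` is a determinant times `br t s`, and it was chosen outside A³.
  have hts : br t s ∉ powSucc A 2 := by
    intro hts
    refine hab ?_
    obtain ⟨a1, a2, ha⟩ := hgen a
    obtain ⟨b1, b2, hb⟩ := hgen b
    have ea : a = a1 • t + a2 • s + (a - a1 • t - a2 • s) := by abel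
    have eb : b = b1 • t + b2 • s + (b - b1 • t - b2 • s) := by abel
    have hb2 := br_mem_powSucc_two a hb
    have ha2 := br_mem_powSucc_two (b1 • t + b2 • s) ha
    rw [← hz]
    have : br a b = (a1 * b2 - a2 * b1) • br t s - br (b1 • t + b2 • s) (a - a1 • t - a2 • s) +
        br a (b - b1 • t - b2 • s) := by
      generalize a - a1 • t - a2 • s = u at ea ha2 ⊢
      generalize b - b1 • t - b2 • s = v at eb hb2 ⊢
      rw [eb, ea]
      simp only [br, mul_add, add_mul, smul_mul_assoc, mul_smul_comm]
      module
    rw [this]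
    exact add_mem (sub_mem (Submodule.smul_mem _ _ hts) ha2) hb2
  obtain ⟨z', hz'⟩ : ∃ z', br t s = z' := ⟨_, rfl⟩
  rw [hz'] at hts
  have hz1' : z' ∈ powSucc A 1 := hz' ▸ br_mem_powSucc_one t s
  obtain ⟨k, u, hu, hk⟩ := dec hz1'
  have hk0 : k ≠ 0 := by
    rintro rfl
    exact hts (by rw [hk, zero_smul, zero_add]; exact hu)
  have hw2 : br t z' ∈ powSucc A 2 := br_mem_powSucc_two t hz1'
  have hw0 : br t z' ≠ 0 := by
    rw [hk, br_add, br_smul, hs.br_eq_zero hu, add_zero]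
    exact smul_ne_zero hk0 ht
  have hsz' : br s z' = 0 := by
    rw [hk, br_add, br_smul, hs.br_eq_zero hu, hsz, smul_zero, add_zero]
  obtain ⟨α, hα⟩ := hs.eq_smul _ hw2 hw0 _ (hc2 t t)
  obtain ⟨β, hβ⟩ := hs.eq_smul _ hw2 hw0 _ (hc2 t s)
  obtain ⟨γ, hγ⟩ := hs.eq_smul _ hw2 hw0 _ (hc2 s s)
  have hc1' : ∀ x, circ x z' = 0 := fun x => hc1 x z' hz1'
  refine ⟨t, s, z', br t z', α, β, γ, hgen, hw2, ?_, ?_, ?_, ?_, ?_, ?_, ?_, ?_, ?_⟩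
  · rw [← circ_self, hα]
  · rw [mul_eq_circ_add_br, hβ, hz', add_comm]
  · rw [mul_eq_circ_add_br, circ_comm, hβ, br_antisymm s t, hz', add_comm]
  · rw [← circ_self, hγ]
  · rw [mul_eq_circ_add_br, hc1', zero_add]
  · rw [mul_eq_circ_add_br, circ_comm, hc1', zero_add, br_antisymm]
  · rw [mul_eq_circ hsz', hc1']
  · rw [mul_eq_circ (br_eq_zero_symm hsz'), circ_comm, hc1']
  · rw [← circ_self, hc1']

/-- Base change x ↦ px + qy, y ↦ ry, keeping the line of y. The new third vector is exactly the new
product xy, so the whole symmetric part of the mixed products appears in yx, whence the factor 2 in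
`h2`. The new fourth vector is p²r w. -/
theorem isomorphic_filiform_table (hdim : Module.finrank ℂ A = 4) (hn : IsNilpotentAlgebra A)
    (hs : HasTwoGeneratorShape A) {x y z w : A} {α β γ p q r α' β' γ' : ℂ} (hp : p ≠ 0)
    (hr : r ≠ 0) (hgen : ∀ t, ∃ a b : ℂ, t - a • x - b • y ∈ powSucc A 1)
    (hw : w ∈ powSucc A 2)
    (hxx : x * x = α • w) (hxy : x * y = z + β • w) (hyx : y * x = -z + β • w)
    (hyy : y * y = γ • w) (hxz : x * z = w) (hzx : z * x = -w) (hyz : y * z = 0)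
    (hzy : z * y = 0) (hzz : z * z = 0)
    (h1 : p ^ 2 * α + 2 * p * q * β + q ^ 2 * γ = α' * (p ^ 2 * r))
    (h2 : 2 * (p * r * β + q * r * γ) = β' * (p ^ 2 * r))
    (h3 : r ^ 2 * γ = γ' * (p ^ 2 * r)) {T : Table}
    (hT : T = !![α' • e₄, e₃, e₄, 0; -e₃ + β' • e₄, γ' • e₄, 0, 0; -e₄, 0, 0, 0; 0, 0, 0, 0]) :
    Isomorphic A (TableAlgebra T) := by
  subst hT
  have hl : ∀ t, t * w = 0 := fun t => (hs.annihilates w hw t).1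
  have hr' : ∀ t, w * t = 0 := fun t => (hs.annihilates w hw t).2
  refine isomorphic_of_generates hdim hn _ ![p • x + q • y, r • y,
    (p * r) • z + (p * r * β + q * r * γ) • w, (p ^ 2 * r) • w] ?_
    (mul_table_of_entries fun i j => ?_)
  · refine eq_top_iff.2 fun t _ => ?_
    obtain ⟨k, l, hkl⟩ := hgen t
    have : t = (k / p) • (p • x + q • y) + ((l - k * q / p) / r) • (r • y) +
        (t - k • x - l • y) := by
      match_scalars <;> field_simp <;> ring
    rw [this]
    refine add_mem (Submodule.mem_sup_left (add_mem ?_ ?_)) (Submodule.mem_sup_right hkl)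
    · exact Submodule.smul_mem _ _ (Submodule.subset_span ⟨0, rfl⟩)
    · exact Submodule.smul_mem _ _ (Submodule.subset_span ⟨1, rfl⟩)
  · fin_cases i <;> fin_cases j <;>
      simp [e₃, e₄, smul_mul_assoc, mul_smul_comm, mul_add, add_mul, hl, hr', hxx, hxy, hyx, hyy,
        hxz, hzx, hyz, hzy, hzz]
    · match_scalars
      · linear_combination h1
      · ring
    · module
    · module
    · match_scalars
      · ring
      · linear_combination h2
    · match_scalars
      linear_combination h3
    · module

theorem IsKokoris.exists_isomorphic_of_cubes_eq_zero (h : IsKokoris A)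
    (hdim : Module.finrank ℂ A = 4) (hn : IsNilpotentAlgebra A) (hs : HasTwoGeneratorShape A)
    (h2 : ¬ IsTwoStepNilpotent A) (h3 : ∀ x : A, x * (x * x) = 0) :
    ∃ i, Isomorphic A (TableAlgebra (kokorisTable i)) := by
  obtain ⟨x, y, z, w, α, β, γ, hgen, hw, hxx, hxy, hyx, hyy, hxz, hzx, hyz, hzy, hzz⟩ :=
    h.exists_basis_of_cubes_eq_zero hs h2 h3
  have key := fun (p q r α' β' γ' : ℂ) (hp : p ≠ 0) (hr : r ≠ 0) =>
    isomorphic_filiform_table (p := p) (q := q) (r := r) (α' := α') (β' := β') (γ' := γ') hdim hn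
      hs hp hr hgen hw hxx hxy hyx hyy hxz hzx hyz hzy hzz
  by_cases hγ : γ = 0
  · subst hγ
    by_cases hβ : β = 0
    · subst hβ
      by_cases hα : α = 0
      · subst hα
        exact ⟨4, key 1 0 1 0 0 0 one_ne_zero one_ne_zero (by ring) (by ring) (by ring)
          (T := J13) (by simp [J13])⟩
      · exact ⟨5, key 1 0 α 1 0 0 one_ne_zero hα (by ring) (by ring) (by ring)
          (T := J14) (by simp [J14])⟩
    -- For γ = 0, q = −α makes p²α + 2pqβ vanish when p = 2β, and that p also normalizes the mixed
    -- term.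
    · exact ⟨6, key (2 * β) (-α) 1 0 1 0 (by simp [hβ]) one_ne_zero (by ring) (by ring) (by ring)
        (T := J15) (by simp [J15])⟩
  -- Taking q = −pβ/γ completes the square; what remains of the form is diagonal with entries α −
  -- β²/γ and γ. When both are nonzero, r = α − β²/γ and p² = rγ make them 1.
  · by_cases hα : α - β ^ 2 / γ = 0
    · exact ⟨7, key 1 (-β / γ) (1 / γ) 0 0 1 one_ne_zero (by simp [hγ])
        (by linear_combination (norm := (field_simp; ring)) hα) (by field_simp; ring)
        (by field_simp) (T := J16) (by simp [J16])⟩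
    · obtain ⟨p, hp⟩ := IsAlgClosed.exists_pow_nat_eq ((α - β ^ 2 / γ) * γ) two_pos
      have hp0 : p ≠ 0 := by
        rintro rfl
        exact mul_ne_zero hα hγ (by simpa using hp.symm)
      exact ⟨8, key p (-p * β / γ) (α - β ^ 2 / γ) 1 0 1 hp0 hα (by field_simp; ring)
        (by field_simp; ring) (by linear_combination -(α - β ^ 2 / γ) * hp)
        (T := J17) (by simp [J17])⟩

end VanishingCubes

/-! ### Case division on the dimension of A² -/

theorem IsKokoris.classification {A : Type u} [NonUnitalNonAssocRing A] [Module ℂ A]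
    [IsScalarTower ℂ A A] [SMulCommClass ℂ A A] (h : IsKokoris A)
    (hdim : Module.finrank ℂ A = 4) (hn : IsNilpotentAlgebra A) (h2 : ¬ IsTwoStepNilpotent A) :
    ∃ i, Isomorphic A (TableAlgebra (kokorisTable i)) := by
  have : FiniteDimensional ℂ A := .of_finrank_pos (by omega)
  have h1 : 2 ≤ Module.finrank ℂ (powSucc A 1) := by
    by_contra h1
    exact h2 (hn.isTwoStepNilpotent_of_finrank_le_one (by omega))
  by_cases hd : Module.finrank ℂ (powSucc A 1) = 2
  · have hs := hn.hasTwoGeneratorShape hdim hd h2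
    by_cases h3 : ∀ x : A, x * (x * x) = 0
    · exact h.exists_isomorphic_of_cubes_eq_zero hdim hn hs h2 h3
    · push Not at h3
      obtain ⟨x, hx⟩ := h3
      exact h.exists_isomorphic_of_cube_ne_zero hdim hn hs hx
  · obtain ⟨x, hx⟩ : ∃ x, x ∉ powSucc A 1 := by
      by_contra! H
      have htop : (⊥ : Submodule ℂ A) = ⊤ := by
        refine hn.eq_top (fun x hx y _ => ?_) ?_
        · rw [(Submodule.mem_bot ℂ).1 hx, zero_mul]
          exact zero_mem _
        · exact eq_top_iff.2 fun x _ => Submodule.mem_sup_right (H x)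
      have := finrank_top ℂ A
      rw [← htop, finrank_bot] at this
      omega
    have hlt := finrank_lt_finrank_sup_span hx
    refine ⟨9, h.isomorphic_J18 (x := x) hdim hn
      (Submodule.eq_top_of_finrank_eq (le_antisymm (Submodule.finrank_le _) ?_))⟩
    omega

end Kokoris

theorem mainTheorem8 :
    (∀ (A : Type u) [NonUnitalNonAssocRing A] [Module ℂ A] [IsScalarTower ℂ A A]
        [SMulCommClass ℂ A A],
      Module.finrank ℂ A = 4 → Kokoris.IsKokoris A → Kokoris.IsNilpotentAlgebra A →
        Kokoris.IsTwoStepNilpotent A ∨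
          ∃ i, Kokoris.Isomorphic A (Kokoris.TableAlgebra (Kokoris.kokorisTable i))) ∧
    (∀ i,
      Module.finrank ℂ (Kokoris.TableAlgebra (Kokoris.kokorisTable i)) = 4 ∧
      Kokoris.IsKokoris (Kokoris.TableAlgebra (Kokoris.kokorisTable i)) ∧
      Kokoris.IsNilpotentAlgebra (Kokoris.TableAlgebra (Kokoris.kokorisTable i)) ∧
      ¬ Kokoris.IsTwoStepNilpotent (Kokoris.TableAlgebra (Kokoris.kokorisTable i))) ∧
    (∀ i j, i ≠ j →
      ¬ Kokoris.Isomorphic (Kokoris.TableAlgebra (Kokoris.kokorisTable i))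
        (Kokoris.TableAlgebra (Kokoris.kokorisTable j))) := by
  exact ⟨fun A _ _ _ _ hdim hK hn => or_iff_not_imp_left.2 fun h2 => hK.classification hdim hn h2,
    Kokoris.kokorisTable_spec, Kokoris.not_isomorphic_kokorisTable⟩
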